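/- Let $\ell^2=\ell^2(\mathbb Z;\mathbb R)$ and $X=\ell^2\times\ell^2$ with its Borel $\sigma$-algebra. Let $p\ge 1$ be an integer, let $d_1,d_2,a_1,a_2,b_1,b_2>0$, let $f,g,h,\delta\in\ell^2$, and let $\sigma_i:\mathbb R\to\mathbb R$ ($i\in\mathbb Z$) satisfy, for some constants $L_\sigma>0$ and $\beta$, $$|\sigma_i(s)-\sigma_i(t)|\le L_\sigma|s-t|,\qquad |\sigma_i(s)|\le\delta_i+\beta|s|\qquad(i\in\mathbb Z,\ s,t\in\mathbb R).$$ Put $(Au)_i=-u_{i-1}+2u_i-u_{i+1}$, $F(u,v)_i=u_i^{2p}v_i$, $G(u)_i=u_i^{2p+1}$ and $\sigma(u)_i=\sigma_i(u_i)$. For $\Delta>0$, the backward Euler–Maruyama scheme for the lattice reversible Selkov system passes from a state $(u_m,v_m)\in X$ to a state $(u_{m+1},v_{m+1})\in X$ with $$\begin{aligned}u_{m+1}&=u_m-d_1Au_{m+1}\Delta-a_1u_{m+1}\Delta+b_1F(u_{m+1},v_{m+1})\Delta-b_2G(u_{m+1})\Delta+f\Delta+[h+\sigma(u_m)]\,\Delta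 W_m,\\ v_{m+1}&=v_m-d_2Av_{m+1}\Delta-a_2v_{m+1}\Delta-b_1F(u_{m+1},v_{m+1})\Delta+b_2G(u_{m+1})\Delta+g\Delta+[h+\sigma(v_m)]\,\Delta W_m,\end{aligned}$$ where the increments $\Delta W_m$ of a real Wiener process are independent and $N(0,\Delta)$-distributed. An implicit step may have more than one solution. A transition kernel of the scheme is a Markov kernel $P$ on $X$ of the form $$P(x,\cdot)=\int_{\mathbb R}K((x,w),\cdot)\,N(0,\Delta)(dw),$$ where $K$ is a Markov kernel from $X\times\mathbb R$ to $X$ such that, for every $x\in X$ and every $w\in\mathbb R$, $K((x,w),\cdot)$-almost every $y$ solves the implicit step with old state $x$ and increment $\Delta W_m=w$ (so $K((x,w),\cdot)$ is the Dirac mass at the solution wherever the solution is unique). A probability measure $\mu$ on $X$ is an invariant measure of the scheme if $\int_XP(x,\cdot)\,\mu(dx)=\mu$ for some transition kernel $P$ of the scheme. Suppose that $\min\{a_1,a_2\}>16\beta^2$. Then there is $\Delta^*>0$ such that for every $\Delta\in(0,\Delta^*)$ the scheme has an invariant probability measure on $X$. -/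

import Mathlib

open MeasureTheory ProbabilityTheory

noncomputable section

/-- The Hilbert space of square-summable real bi-infinite sequences. -/
abbrev Ell2 : Type := lp (fun _ : ℤ => ℝ) 2

/-- `Ell2` carries its Borel sigma-algebra. -/
instance instMeasurableSpaceEll2 : MeasurableSpace Ell2 := borel Ell2

instance instBorelSpaceEll2 : BorelSpace Ell2 := ⟨rfl⟩

/-- The phase space `X = ℓ² × ℓ²`. Its sigma-algebra is the product one, which is the Borel one
because `ℓ²` is separable. -/
abbrev PhaseSpace : Type := Ell2 × Ell2

/-- The data of the lattice reversible Selkov system: the exponent, the constants, the external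
forces, and the noise intensities. No condition is imposed here. -/
structure SelkovData where
  p : ℕ
  d₁ : ℝ
  d₂ : ℝ
  a₁ : ℝ
  a₂ : ℝ
  b₁ : ℝ
  b₂ : ℝ
  f : Ell2
  g : Ell2
  h : Ell2
  σ : ℤ → ℝ → ℝ

/-- The negative discrete Laplacian, `(A u)_i = - u_{i-1} + 2 u_i - u_{i+1}`. -/
def latticeA (u : Ell2) (i : ℤ) : ℝ := -u (i - 1) + 2 * u i - u (i + 1)

/-- `F(u, v)_i = u_i^{2p} v_i`. -/
def selkovF (p : ℕ) (u v : Ell2) (i : ℤ) : ℝ := u i ^ (2 * p) * v i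

/-- `G(u)_i = u_i^{2p+1}`. -/
def selkovG (p : ℕ) (u : Ell2) (i : ℤ) : ℝ := u i ^ (2 * p + 1)

/-- One step of the backward Euler-Maruyama scheme with step size `Δ` and noise increment `w`:
the new state `y` solves the implicit equations with old state `x`. The equality of the two
sequences in `ℓ²` is written coordinate by coordinate. -/
def IsBEMStep (S : SelkovData) (Δ w : ℝ) (x y : PhaseSpace) : Prop :=
  (∀ i : ℤ, y.1 i = x.1 i - S.d₁ * latticeA y.1 i * Δ - S.a₁ * y.1 i * Δ
      + S.b₁ * selkovF S.p y.1 y.2 i * Δ - S.b₂ * selkovG S.p y.1 i * Δ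
      + S.f i * Δ + (S.h i + S.σ i (x.1 i)) * w) ∧
  (∀ i : ℤ, y.2 i = x.2 i - S.d₂ * latticeA y.2 i * Δ - S.a₂ * y.2 i * Δ
      - S.b₁ * selkovF S.p y.1 y.2 i * Δ + S.b₂ * selkovG S.p y.1 i * Δ
      + S.g i * Δ + (S.h i + S.σ i (x.2 i)) * w)

/-- The law of the pair (old state, Wiener increment) when the old state is `x`: the increment
over a time step of length `Δ` is a centred Gaussian of variance `Δ`, independent of `x`. -/
def withIncrement (Δ : ℝ) : Kernel PhaseSpace (PhaseSpace × ℝ) :=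
  Kernel.id ×ₖ Kernel.const PhaseSpace (gaussianReal 0 Δ.toNNReal)

/-- `P` is a one-step transition kernel of the scheme: from every state `x` and for every value
`w` of the increment, the new state, distributed according to `K (x, w)`, almost surely solves the
implicit equations, and `P x` is the law of the new state when `w` is the Wiener increment.
(An implicit step may have several solutions; where it has only one, `K (x, w)` is the Dirac mass
at that solution.) -/
def IsBEMTransition (S : SelkovData) (Δ : ℝ) (P : Kernel PhaseSpace PhaseSpace) : Prop :=
  ∃ K : Kernel (PhaseSpace × ℝ) PhaseSpace, IsMarkovKernel K ∧
    (∀ (x : PhaseSpace) (w : ℝ), ∀ᵐ y ∂(K (x, w)), IsBEMStep S Δ w x y) ∧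
    P = K ∘ₖ withIncrement Δ

/-- `μ` is an invariant measure of the scheme: a probability measure on the phase space that is
invariant under a transition kernel of the scheme. -/
def IsBEMInvariantMeasure (S : SelkovData) (Δ : ℝ) (μ : Measure PhaseSpace) : Prop :=
  IsProbabilityMeasure μ ∧
    ∃ P : Kernel PhaseSpace PhaseSpace, IsBEMTransition S Δ P ∧ Kernel.Invariant P μ

/-- If every implicit step has exactly one solution, then the transition kernel is the kernel of
the Markov chain determined by the scheme. -/
theorem IsBEMTransition.apply_eq_map {S : SelkovData} {Δ : ℝ} {P : Kernel PhaseSpace PhaseSpace}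
    (hP : IsBEMTransition S Δ P) (Φ : PhaseSpace × ℝ → PhaseSpace) (hΦ : Measurable Φ)
    (huniq : ∀ x w y, IsBEMStep S Δ w x y → y = Φ (x, w)) (x : PhaseSpace) :
    P x = (gaussianReal 0 Δ.toNNReal).map (fun w => Φ (x, w)) := by
  obtain ⟨K, hK, hstep, rfl⟩ := hP
  have hKΦ : K = Kernel.deterministic Φ hΦ := by
    ext1 z
    obtain ⟨x, w⟩ := z
    rw [Kernel.deterministic_apply]
    have h1 : ∀ᵐ y ∂(K (x, w)), y = Φ (x, w) := by
      filter_upwards [hstep x w] with y hy using huniq x w y hy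
    have h2 : (K (x, w)).map id = (K (x, w)).map (fun _ => Φ (x, w)) :=
      Measure.map_congr h1
    rw [Measure.map_id, Measure.map_const, measure_univ, one_smul] at h2
    exact h2
  subst hKΦ
  rw [Kernel.comp_apply, withIncrement, Kernel.prod_apply, Kernel.id_apply, Kernel.const_apply,
    Measure.deterministic_comp_eq_map, Measure.dirac_prod,
    Measure.map_map hΦ (by fun_prop)]
  rfl

end

/-! An implicit step may have several solutions and a selected solution need not depend continuously
on the data, so the Feller property is not available. What survives is closedness: each implicit
equation involves finitely many coordinates, so the set of triples (old state, increment, new state)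
solving the step is closed for coordinatewise convergence. In that topology the energy balls are
compact.

The energy is b₂‖u‖² + b₁‖v‖². With these weights the reaction terms combine to the nonnegative
quantity u^{2p}(b₂u − b₁v)², so, with λ = min{a₁, a₂}, some solution has at most the energy of the
right-hand side divided by (1 + λΔ)². Solutions exist on finite windows by a Brouwer-type argument
(`exists_zero_of_inner_pos`) and on the whole lattice by compactness (`exists_solution`). A
measurable selection (`NoiseBound.exists_measurable_step`) turns them into a Markov chain. Averaging
over the Gaussian increment, the energy contracts up to a constant as soon as 2β² < λ, so the chain
started at rest is tight.

`exists_invariant_of_isClosed_relation` then runs Krylov–Bogoliubov on the joint laws of the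
triples. A limit law still lives on the closed relation, its increment is still independent of the
old state, and its first and last marginals agree. Its disintegration is a transition kernel with an
invariant measure. -/

/-! ### Zeros of outward-pointing vector fields (Brouwer). -/

/-- `det (1 + t A)` is a polynomial in `t`, so it is recovered from its values at enough nodes by
Lagrange interpolation. -/
theorem det_one_add_smul_eq_sum_basis {E : Type*} [NormedAddCommGroup E] [NormedSpace ℝ E]
    [FiniteDimensional ℝ E] (s : Finset ℝ) (hs : Module.finrank ℝ E < s.card)
    (A : E →L[ℝ] E) (t : ℝ) :
    (1 + t • A).det = ∑ j ∈ s, (Lagrange.basis s id j).eval t * (1 + j • A).det := by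
  classical
  set b := Module.finBasis ℝ E
  set M := LinearMap.toMatrix b b (A : E →ₗ[ℝ] E) with hM
  -- The determinant of X M + 1 has degree at most the dimension, so more nodes than the dimension
  -- determine it.
  set q : Polynomial ℝ := Matrix.det ((Polynomial.X : Polynomial ℝ) • M.map Polynomial.C
    + (1 : Matrix _ _ ℝ).map Polynomial.C) with hq
  have hdeg : q.natDegree ≤ Module.finrank ℝ E := by
    have := Polynomial.natDegree_det_X_add_C_le M 1
    rwa [Fintype.card_fin] at this
  have heval : ∀ r : ℝ, q.eval r = (1 + r • A).det := by
    intro r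
    have h1 : q.eval r = (r • M + 1).det := by
      rw [hq, ← Polynomial.coe_evalRingHom, RingHom.map_det]
      congr 1
      ext i j
      by_cases hij : i = j <;> simp [hij, mul_comm r]
    rw [h1, ContinuousLinearMap.det, ← LinearMap.det_toMatrix b]
    congr 1
    rw [hM, ContinuousLinearMap.toLinearMap_add, ContinuousLinearMap.toLinearMap_smul, map_add,
      map_smul, add_comm]
    congr 1
    exact (LinearMap.toMatrix_one b).symm
  have hlt : q.degree < s.card :=
    lt_of_le_of_lt Polynomial.degree_le_natDegree (by exact_mod_cast lt_of_le_of_lt hdeg hs)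
  have h := Lagrange.eq_interpolate (v := id) (Set.injOn_id (s : Set ℝ)) hlt
  rw [← heval t, h, Lagrange.interpolate_apply, Polynomial.eval_finsetSum]
  refine Finset.sum_congr rfl fun j _ => ?_
  rw [Polynomial.eval_mul, Polynomial.eval_C, id, heval j, mul_comm]

/-- A small Lipschitz perturbation of the identity of the form `x + t (r x - x)`, where `r` maps the
closed ball to itself and fixes the sphere, maps the open ball onto itself. -/
theorem image_ball_add_smul_eq {E : Type*} [NormedAddCommGroup E] [InnerProductSpace ℝ E]
    [FiniteDimensional ℝ E] {R : ℝ} (hR : 0 < R) {r : E → E}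
    (hr : ∀ x, ‖x‖ ≤ R → ‖r x‖ ≤ R) (hfix : ∀ x, ‖x‖ = R → r x = x) {C : NNReal}
    (hC : LipschitzOnWith C (fun x => r x - x) (Metric.closedBall 0 R)) {t : ℝ}
    (ht0 : 0 < t) (ht1 : t < 1) (htC : t * C < 1) :
    Set.InjOn (fun x => x + t • (r x - x)) (Metric.ball 0 R) ∧
    (fun x => x + t • (r x - x)) '' (Metric.ball 0 R) = Metric.ball 0 R := by
  set F : E → E := fun x => x + t • (r x - x) with hF
  -- `F` differs from the identity by a map of Lipschitz constant t C < 1, hence is injective and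
  -- open on the ball.
  have happ : ApproximatesLinearOn F ((ContinuousLinearEquiv.refl ℝ E : E ≃L[ℝ] E) : E →L[ℝ] E)
      (Metric.closedBall 0 R) (t.toNNReal * C) := by
    intro x hx y hy
    have h := hC.dist_le_mul x hx y hy
    rw [dist_eq_norm, dist_eq_norm] at h
    have : F x - F y - ((ContinuousLinearEquiv.refl ℝ E : E ≃L[ℝ] E) : E →L[ℝ] E) (x - y)
        = t • ((r x - x) - (r y - y)) := by
      simp only [hF, ContinuousLinearEquiv.coe_refl, ContinuousLinearMap.id_apply]
      module
    rw [this, norm_smul, Real.norm_of_nonneg ht0.le, NNReal.coe_mul, Real.coe_toNNReal _ ht0.le,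
      mul_assoc]
    exact mul_le_mul_of_nonneg_left h ht0.le
  have hsmall : Subsingleton E ∨ t.toNNReal * C <
      ‖((ContinuousLinearEquiv.refl ℝ E).symm : E →L[ℝ] E)‖₊⁻¹ := by
    rcases subsingleton_or_nontrivial E with h | h
    · exact Or.inl h
    · right
      have : ‖((ContinuousLinearEquiv.refl ℝ E).symm : E →L[ℝ] E)‖₊ = 1 := by
        rw [ContinuousLinearEquiv.refl_symm, ContinuousLinearEquiv.coe_refl]
        exact ContinuousLinearMap.nnnorm_id
      rw [this, inv_one, ← NNReal.coe_lt_coe, NNReal.coe_mul, Real.coe_toNNReal _ ht0.le]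
      exact_mod_cast htC
  have hsub := Metric.ball_subset_closedBall (x := (0 : E)) (ε := R)
  have hball := happ.mono_set hsub
  refine ⟨hball.injOn hsmall, ?_⟩
  have hopen : IsOpen (F '' Metric.ball 0 R) :=
    (hball.toOpenPartialHomeomorph F _ hsmall Metric.isOpen_ball).open_target
  have hmaps : F '' Metric.ball 0 R ⊆ Metric.ball 0 R := by
    rintro _ ⟨x, hx, rfl⟩
    rw [mem_ball_zero_iff] at hx ⊢
    have : F x = (1 - t) • x + t • r x := by simp only [hF]; module
    rw [this]
    calc ‖(1 - t) • x + t • r x‖ ≤ (1 - t) * ‖x‖ + t * ‖r x‖ := by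
          refine (norm_add_le _ _).trans ?_
          rw [norm_smul, norm_smul, Real.norm_of_nonneg ht0.le, Real.norm_of_nonneg (by linarith)]
      _ < (1 - t) * R + t * R := by
          have := mul_lt_mul_of_pos_left hx (by linarith : 0 < 1 - t)
          have := mul_le_mul_of_nonneg_left (hr x hx.le) ht0.le
          linarith
      _ = R := by ring
  refine Set.Subset.antisymm hmaps ?_
  -- The image is open, and closed relative to the ball: a limit point inside the ball is the image
  -- of a point of the closed ball, which is not on the sphere because the sphere is fixed.
  have hconn : IsPreconnected (Metric.ball (0 : E) R) := (convex_ball 0 R).isPreconnected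
  refine hconn.subset_of_closure_inter_subset hopen ?_ ?_
  · have h0 : (0 : E) ∈ Metric.ball (0 : E) R := Metric.mem_ball_self hR
    exact ⟨F 0, hmaps ⟨0, h0, rfl⟩, 0, h0, rfl⟩
  · have hcl : closure (F '' Metric.ball 0 R) ⊆ F '' Metric.closedBall 0 R :=
      closure_minimal (Set.image_mono hsub)
        ((isCompact_closedBall 0 R).image_of_continuousOn happ.continuousOn).isClosed
    rintro z ⟨hz1, hz2⟩
    obtain ⟨x, hx, rfl⟩ := hcl hz1
    refine ⟨x, ?_, rfl⟩
    rw [mem_closedBall_zero_iff] at hx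
    rw [mem_ball_zero_iff] at hz2 ⊢
    refine lt_of_le_of_ne hx fun h => ?_
    have : F x = x := by simp [hF, hfix x h]
    rw [this] at hz2
    linarith

/-- There is no `C¹` retraction of a closed ball onto its sphere (Milnor–Rogers argument). -/
theorem no_contDiffOn_retraction {E : Type*} [NormedAddCommGroup E] [InnerProductSpace ℝ E]
    [FiniteDimensional ℝ E] {R : ℝ} (hR : 0 < R) {r : E → E} {U : Set E} (hU : IsOpen U)
    (hBU : Metric.closedBall 0 R ⊆ U) (hrU : ContDiffOn ℝ 1 r U)
    (hr : ∀ x, ‖x‖ ≤ R → ‖r x‖ = R) (hfix : ∀ x, ‖x‖ = R → r x = x) : False := by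
  let _ : MeasurableSpace E := borel E
  have : BorelSpace E := ⟨rfl⟩
  set B := Metric.closedBall (0 : E) R
  set O := Metric.ball (0 : E) R
  have hOB : O ⊆ B := Metric.ball_subset_closedBall
  set A : E → (E →L[ℝ] E) := fun x => fderiv ℝ r x - 1 with hA
  have hd : ∀ x ∈ U, HasFDerivAt r (fderiv ℝ r x) x := fun x hx =>
    ((hrU.differentiableOn one_ne_zero).differentiableAt (hU.mem_nhds hx)).hasFDerivAt
  have hAd : ∀ x ∈ U, HasFDerivAt (fun x => r x - x) (A x) x := fun x hx =>
    (hd x hx).sub (hasFDerivAt_id x)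
  have hAc : ContinuousOn A B :=
    (((hrU.continuousOn_fderiv_of_isOpen hU le_rfl).sub continuousOn_const)).mono hBU
  obtain ⟨C, hC⟩ : ∃ C : NNReal, ∀ x ∈ B, ‖A x‖ ≤ C := by
    obtain ⟨C, hC⟩ := (isCompact_closedBall (0 : E) R).exists_bound_of_continuousOn hAc
    exact ⟨C.toNNReal, fun x hx => (hC x hx).trans (Real.le_coe_toNNReal C)⟩
  have hLip : LipschitzOnWith C (fun x => r x - x) B :=
    (convex_closedBall (0 : E) R).lipschitzOnWith_of_nnnorm_hasFDerivWithin_le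
      (fun x hx => (hAd x (hBU hx)).hasFDerivWithinAt) (fun x hx => by exact_mod_cast hC x hx)
  have hdetc : Continuous (fun T : E →L[ℝ] E => T.det) := ContinuousLinearMap.continuous_det
  obtain ⟨η, hη, hdetpos⟩ : ∃ η > 0, ∀ T : E →L[ℝ] E, ‖T - 1‖ < η → 0 < T.det := by
    have h1 : ∀ᶠ T : E →L[ℝ] E in nhds 1, 0 < T.det := by
      refine hdetc.continuousAt.eventually (lt_mem_nhds ?_)
      have : (1 : E →L[ℝ] E).det = 1 := by
        rw [ContinuousLinearMap.det]; exact LinearMap.det_id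
      exact this.ge.trans_lt' one_pos
    obtain ⟨η, hη, h⟩ := Metric.eventually_nhds_iff.1 h1
    exact ⟨η, hη, fun T hT => h (by rwa [dist_eq_norm])⟩
  have hC0 : (0 : ℝ) ≤ C := C.2
  obtain ⟨ε, hε0, hε1, hεC, hεη⟩ :
      ∃ ε : ℝ, 0 < ε ∧ ε ≤ 1 ∧ ε * (C + 1) ≤ 1 ∧ ε * (C + 1) ≤ η := by
    refine ⟨min 1 η / (C + 1), by positivity, ?_, ?_, ?_⟩
    · rw [div_le_one (by positivity)]
      linarith [min_le_left (1 : ℝ) η]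
    · rw [div_mul_cancel₀ _ (by positivity)]; exact min_le_left _ _
    · rw [div_mul_cancel₀ _ (by positivity)]; exact min_le_right _ _
  have hint : ∀ t : ℝ, IntegrableOn (fun x => (1 + t • A x).det) O := by
    intro t
    have : ContinuousOn (fun x => (1 + t • A x).det) B :=
      hdetc.comp_continuousOn (continuousOn_const.add (hAc.const_smul t))
    exact (this.integrableOn_compact (isCompact_closedBall 0 R)).mono_set hOB
  -- For small t the deformation is a bijection of the ball with positive Jacobian determinant, so
  -- the integral of that determinant is the volume of the ball.
  have hvol : ∀ t : ℝ, 0 < t → t < ε → ∫ x in O, (1 + t • A x).det = volume.real O := by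
    intro t ht0 htε
    have hlt : t * C < ε * (C + 1) := by nlinarith
    obtain ⟨hinj, himg⟩ := image_ball_add_smul_eq hR (fun x hx => (hr x hx).le) hfix hLip ht0
      (htε.trans_le hε1) (hlt.trans_le hεC)
    have hfd : ∀ x ∈ O, HasFDerivWithinAt (fun x => x + t • (r x - x)) (1 + t • A x) O x :=
      fun x hx => ((hasFDerivAt_id x).add
        ((hAd x (hBU (hOB hx))).const_smul t)).hasFDerivWithinAt
    have h := integral_image_eq_integral_abs_det_fderiv_smul volume
      (Metric.isOpen_ball (x := (0 : E)) (ε := R)).measurableSet hfd hinj (fun _ => (1 : ℝ))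
    rw [himg] at h
    simp only [smul_eq_mul, mul_one, integral_const, MeasurableSet.univ, measureReal_restrict_apply,
      Set.univ_inter] at h
    rw [h]
    refine setIntegral_congr_fun Metric.isOpen_ball.measurableSet fun x hx => ?_
    refine (abs_of_pos (hdetpos _ ?_)).symm
    rw [add_sub_cancel_left, norm_smul, Real.norm_of_nonneg ht0.le]
    exact (mul_le_mul_of_nonneg_left (hC x (hOB hx)) ht0.le).trans_lt (hlt.trans_le hεη)
  obtain ⟨s, hs, hcard⟩ := (Set.Ioo_infinite hε0).exists_subset_card_eq (Module.finrank ℝ E + 1)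
  -- The integral is polynomial in t and constant on (0, ε), so it has the same value at t = 1.
  have hone : ∫ x in O, (1 + (1 : ℝ) • A x).det = volume.real O := by
    simp_rw [det_one_add_smul_eq_sum_basis s (by omega) (A _) 1]
    rw [integral_finsetSum _ fun j _ => (hint j).const_mul _]
    calc ∑ j ∈ s, ∫ x in O, (Lagrange.basis s id j).eval 1 * (1 + j • A x).det
        = ∑ j ∈ s, (Lagrange.basis s id j).eval 1 * volume.real O := by
          refine Finset.sum_congr rfl fun j hj => ?_
          rw [integral_const_mul, hvol j (hs hj).1 (hs hj).2]
      _ = volume.real O := by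
          rw [← Finset.sum_mul, ← Polynomial.eval_finsetSum,
            Lagrange.sum_basis (Set.injOn_id _) (Finset.card_pos.1 (by omega)),
            Polynomial.eval_one, one_mul]
  have hzero : ∫ x in O, (1 + (1 : ℝ) • A x).det = 0 := by
    refine setIntegral_eq_zero_of_forall_eq_zero fun x hx => ?_
    have hx' : x ∈ U := hBU (hOB hx)
    have hD : 1 + (1 : ℝ) • A x = fderiv ℝ r x := by simp [hA]
    rw [hD]
    by_contra hdet
    -- Differentiating ‖r‖² = R² makes the range of the derivative orthogonal to `r x`; an
    -- invertible derivative would force `r x = 0`.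
    have hconst : (fun y => inner ℝ (r y) (r y)) =ᶠ[nhds x] fun _ => R ^ 2 := by
      filter_upwards [Metric.isOpen_ball.mem_nhds hx] with y hy
      rw [real_inner_self_eq_norm_sq, hr y (mem_closedBall_zero_iff.1 (hOB hy))]
    have h1 := (hd x hx').inner ℝ (hd x hx')
    have h2 := (hasFDerivAt_const (R ^ 2) x (𝕜 := ℝ)).congr_of_eventuallyEq hconst
    have h3 := h1.unique h2
    have hsurj : Function.Surjective (fderiv ℝ r x) := by
      have := (LinearMap.isUnit_iff_isUnit_det _).2 (isUnit_iff_ne_zero.2 hdet)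
      exact ((Module.End.isUnit_iff _).1 this).2
    obtain ⟨v, hv⟩ := hsurj (r x)
    have h4 := congrArg (fun T : E →L[ℝ] ℝ => T v) h3
    simp [fderivInnerCLM_apply, hv] at h4
    have h5 := hr x (mem_closedBall_zero_iff.1 (hOB hx))
    rw [h4, norm_zero] at h5
    linarith
  have hpos : 0 < volume.real O :=
    ENNReal.toReal_pos (Metric.measure_ball_pos volume 0 hR).ne' measure_ball_lt_top.ne
  rw [hone] at hzero
  linarith

/-- A `C¹` vector field on a finite-dimensional inner product space that points outwards on a sphere
vanishes somewhere in the closed ball. -/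
theorem exists_zero_of_inner_pos {E : Type*} [NormedAddCommGroup E] [InnerProductSpace ℝ E]
    [FiniteDimensional ℝ E] {R : ℝ} (hR : 0 < R) {Φ : E → E} (hΦ : ContDiff ℝ 1 Φ)
    (hpos : ∀ x, ‖x‖ = R → 0 < inner ℝ (Φ x) x) : ∃ x, ‖x‖ ≤ R ∧ Φ x = 0 := by
  by_contra! hne
  -- A quarter of the discriminant of ‖x + λ Φ x‖² = R² as a quadratic in λ; `lam` is its larger
  -- root. Without zeros of `Φ`, moving from x along `Φ x` to the sphere is a retraction: on the
  -- sphere the outward condition makes the larger root 0.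
  set D : E → ℝ := fun x => inner ℝ (Φ x) x ^ 2 + ‖Φ x‖ ^ 2 * (R ^ 2 - ‖x‖ ^ 2) with hD
  have hDs : ContDiff ℝ 1 D := by
    have h1 : ContDiff ℝ 1 fun x => inner ℝ (Φ x) x := hΦ.inner ℝ contDiff_id
    have h2 : ContDiff ℝ 1 fun x => ‖Φ x‖ ^ 2 := hΦ.norm_sq ℝ
    have h3 : ContDiff ℝ 1 fun x : E => ‖x‖ ^ 2 := contDiff_id.norm_sq ℝ
    exact (h1.pow 2).add (h2.mul (contDiff_const.sub h3))
  set lam : E → ℝ := fun x => (-inner ℝ (Φ x) x + √(D x)) / ‖Φ x‖ ^ 2 with hlam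
  have hDpos : ∀ x, ‖x‖ ≤ R → 0 < D x := by
    intro x hx
    rcases hx.lt_or_eq with h | h
    · have h1 : 0 < ‖Φ x‖ ^ 2 := by have := norm_pos_iff.2 (hne x hx); positivity
      have h2 : 0 < R ^ 2 - ‖x‖ ^ 2 := by nlinarith [norm_nonneg x]
      have := mul_pos h1 h2
      simp only [hD]; positivity
    · have := hpos x h
      simp only [hD, h, sub_self, mul_zero, add_zero]; positivity
  refine no_contDiffOn_retraction (r := fun x => x + lam x • Φ x)
    (U := {x | 0 < D x} ∩ {x | Φ x ≠ 0}) hR ?_ ?_ ?_ ?_ ?_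
  · exact (isOpen_lt continuous_const hDs.continuous).inter
      (isOpen_ne_fun hΦ.continuous continuous_const)
  · intro x hx
    rw [mem_closedBall_zero_iff] at hx
    exact ⟨hDpos x hx, hne x hx⟩
  · refine contDiffOn_id.add (ContDiffOn.smul (ContDiffOn.div ?_ ?_ ?_) hΦ.contDiffOn)
    · exact (hΦ.inner ℝ contDiff_id).neg.contDiffOn.add
        (hDs.contDiffOn.sqrt fun x hx => hx.1.ne')
    · exact (hΦ.norm_sq ℝ).contDiffOn
    · intro x hx
      exact pow_ne_zero 2 (norm_ne_zero_iff.2 hx.2)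
  · intro x hx
    have hn : ‖Φ x‖ ^ 2 ≠ 0 := pow_ne_zero 2 (norm_ne_zero_iff.2 (hne x hx))
    have hs : √(D x) ^ 2 = D x := Real.sq_sqrt (hDpos x hx).le
    have hl : lam x * ‖Φ x‖ ^ 2 = -inner ℝ (Φ x) x + √(D x) := div_mul_cancel₀ _ hn
    have hsq : ‖x + lam x • Φ x‖ ^ 2 = R ^ 2 := by
      rw [norm_add_sq_real, norm_smul, inner_smul_right, mul_pow, Real.norm_eq_abs, sq_abs,
        real_inner_comm]
      have h1 : (lam x * ‖Φ x‖ ^ 2 + inner ℝ (Φ x) x) ^ 2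
          = inner ℝ (Φ x) x ^ 2 + ‖Φ x‖ ^ 2 * (R ^ 2 - ‖x‖ ^ 2) := by
        rw [hl, neg_add_cancel_comm, hs]
      have h2 : ‖Φ x‖ ^ 2 * (‖x‖ ^ 2 + 2 * (lam x * inner ℝ (Φ x) x)
          + lam x ^ 2 * ‖Φ x‖ ^ 2) = ‖Φ x‖ ^ 2 * R ^ 2 := by linarith
      exact mul_left_cancel₀ hn h2
    exact (pow_left_inj₀ (norm_nonneg _) hR.le two_ne_zero).1 hsq
  · intro x hx
    have hp := hpos x hx
    have : lam x = 0 := by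
      simp only [hlam, hD, hx, sub_self, mul_zero, add_zero, Real.sqrt_sq hp.le, neg_add_cancel,
        zero_div]
    simp [this]

/-! ### Measurable selection and disintegration. -/

/-- Measurable selection for a closed relation between an arbitrary space and a compact metrizable
space, all of whose sections are nonempty. -/
theorem exists_measurable_selection_of_isClosed {Z K : Type*} [TopologicalSpace Z]
    [MeasurableSpace Z] [OpensMeasurableSpace Z] [TopologicalSpace K] [CompactSpace K]
    [TopologicalSpace.MetrizableSpace K] [MeasurableSpace K] [BorelSpace K] {G : Set (Z × K)}
    (hG : IsClosed G) (hne : ∀ z, ∃ y, (z, y) ∈ G) :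
    ∃ s : Z → K, Measurable s ∧ ∀ z, (z, s z) ∈ G := by
  rcases isEmpty_or_nonempty Z with hZ | ⟨⟨z₀⟩⟩
  · exact ⟨fun z => isEmptyElim z, measurable_of_empty _, fun z => isEmptyElim z⟩
  obtain ⟨y₀, -⟩ := hne z₀
  have : Nonempty K := ⟨y₀⟩
  let _ : MetricSpace K := TopologicalSpace.metrizableSpaceMetric K
  -- `K` is a continuous image of the Cantor set, whose order inherited from ℝ singles out the least
  -- point of each closed section.
  obtain ⟨q, hqc, hqs⟩ := exists_nat_bool_continuous_surjective_of_compact K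
  let e : cantorSet ≃ₜ (ℕ → Bool) := cantorSetHomeomorphNatToBool
  have : CompactSpace cantorSet := isCompact_iff_compactSpace.1 isCompact_cantorSet
  set p : cantorSet → K := fun c => q (e c) with hp
  have hpc : Continuous p := hqc.comp e.continuous
  have hps : Function.Surjective p := hqs.comp e.surjective
  have hH : IsClosed {zc : Z × cantorSet | (zc.1, p zc.2) ∈ G} :=
    hG.preimage (continuous_fst.prodMk (hpc.comp continuous_snd))
  have hmin : ∀ z, ∃ c : cantorSet, (z, p c) ∈ G ∧ ∀ c' : cantorSet, (z, p c') ∈ G → c ≤ c' := by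
    intro z
    have hcl : IsClosed {c : cantorSet | (z, p c) ∈ G} :=
      hG.preimage (continuous_const.prodMk hpc)
    obtain ⟨y, hy⟩ := hne z
    obtain ⟨c, rfl⟩ := hps y
    obtain ⟨m, hm, hle⟩ := hcl.isCompact.exists_isLeast ⟨c, hy⟩
    exact ⟨m, hm, fun c' hc' => hle hc'⟩
  choose t htG htmin using hmin
  refine ⟨fun z => p (t z), hpc.measurable.comp ?_, htG⟩
  suffices h : Measurable fun z => (t z : ℝ) from h.subtype_mk
  refine measurable_of_Iic fun a => ?_
  -- The least point is at most a exactly when some point of the section is, so this is the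
  -- projection of a closed set along a compact factor, hence closed.
  have : (fun z => (t z : ℝ)) ⁻¹' Set.Iic a =
      Prod.fst '' ({zc : Z × cantorSet | (zc.1, p zc.2) ∈ G} ∩ {zc | (zc.2 : ℝ) ≤ a}) := by
    ext z
    constructor
    · exact fun h => ⟨(z, t z), ⟨htG z, h⟩, rfl⟩
    · rintro ⟨⟨z', c⟩, ⟨h1, h2⟩, rfl⟩
      exact (Subtype.coe_le_coe.2 (htmin _ c h1)).trans h2
  rw [this]
  exact (isClosedMap_fst_of_compactSpace _
    (hH.inter (isClosed_le (continuous_subtype_val.comp continuous_snd) continuous_const))).measurableSet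

/-- A disintegration of `ρ` can be corrected on a null set so that it is carried by the sections of
`T` everywhere. -/
theorem exists_markovKernel_of_ae_mem {Z X : Type*} [MeasurableSpace Z] [MeasurableSpace X]
    [StandardBorelSpace X] [Nonempty X] (ρ : Measure (Z × X)) [IsProbabilityMeasure ρ]
    {T : Set (Z × X)} (hT : MeasurableSet T) (hρ : ∀ᵐ z ∂ρ, z ∈ T)
    {s : Z → X} (hs : Measurable s) (hsT : ∀ z, (z, s z) ∈ T) :
    ∃ K : Kernel Z X, IsMarkovKernel K ∧ (∀ z, ∀ᵐ y ∂(K z), (z, y) ∈ T) ∧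
      ρ.fst.bind K = ρ.snd := by
  classical
  set K₀ := ρ.condKernel with hK₀
  -- Despite its name, `bad` collects the points where the conditional law is already carried by the
  -- section; it has full measure, and off it the Dirac mass at `s z` is substituted.
  set bad : Set Z := {z | K₀ z (Prod.mk z ⁻¹' Tᶜ) = 0} with hbad
  have hbadm : MeasurableSet bad :=
    (Kernel.measurable_kernel_prodMk_left hT.compl) (measurableSet_singleton 0)
  refine ⟨Kernel.piecewise hbadm K₀ (Kernel.deterministic s hs), inferInstance, fun z => ?_, ?_⟩
  · rw [Kernel.piecewise_apply]
    split_ifs with h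
    · exact h
    · rw [Kernel.deterministic_apply, ae_dirac_iff (measurable_prodMk_left hT)]
      exact hsT z
  · have hae : ∀ᵐ z ∂ρ.fst, z ∈ bad := by
      have h : ∀ᵐ z ∂(ρ.fst ⊗ₘ K₀), z ∈ T := by rwa [ρ.disintegrate]
      exact Measure.ae_ae_of_ae_compProd h
    have hcongr : ρ.fst.bind (Kernel.piecewise hbadm K₀ (Kernel.deterministic s hs))
        = ρ.fst.bind K₀ := by
      refine Measure.bind_congr_right ?_
      filter_upwards [hae] with z hz
      rw [Kernel.piecewise_apply, if_pos hz]
    rw [hcongr, ← Measure.snd_compProd, ρ.disintegrate]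

/-! ### Cesàro means and a Krylov–Bogoliubov theorem for closed relations. -/

/-- The Cesàro mean `(ν 0 + ⋯ + ν n) / (n + 1)` of a sequence of measures. -/
noncomputable def cesaroMeasure {X : Type*} [MeasurableSpace X] (ν : ℕ → Measure X) (n : ℕ) :
    Measure X :=
  ((n : ENNReal) + 1)⁻¹ • ∑ k ∈ Finset.range (n + 1), ν k

theorem cesaroMeasure_apply {X : Type*} [MeasurableSpace X] (ν : ℕ → Measure X) (n : ℕ)
    (A : Set X) :
    cesaroMeasure ν n A = ((n : ENNReal) + 1)⁻¹ * ∑ k ∈ Finset.range (n + 1), ν k A := by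
  simp [cesaroMeasure, Measure.smul_apply, Measure.finsetSum_apply]

theorem cesaroMeasure_le {X : Type*} [MeasurableSpace X] {ν : ℕ → Measure X} {A : Set X}
    {ε : ENNReal} (h : ∀ k, ν k A ≤ ε) (n : ℕ) : cesaroMeasure ν n A ≤ ε := by
  rw [cesaroMeasure_apply]
  calc _ ≤ ((n : ENNReal) + 1)⁻¹ * (((n : ENNReal) + 1) * ε) := by
        gcongr
        refine (Finset.sum_le_sum fun k _ => h k).trans ?_
        simp
    _ = ε := by
        rw [← mul_assoc, ENNReal.inv_mul_cancel (by simp) (by simp), one_mul]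

instance isProbabilityMeasure_cesaroMeasure {X : Type*} [MeasurableSpace X] (ν : ℕ → Measure X)
    [∀ n, IsProbabilityMeasure (ν n)] (n : ℕ) : IsProbabilityMeasure (cesaroMeasure ν n) := by
  constructor
  rw [cesaroMeasure_apply]
  simp only [measure_univ, Finset.sum_const, Finset.card_range, nsmul_eq_mul, mul_one]
  push_cast
  exact ENNReal.inv_mul_cancel (by simp) (by simp)

/-- One step acts linearly on laws, so advancing a Cesàro mean of the chain gives the Cesàro mean of
the shifted chain. -/
theorem map_prod_cesaroMeasure {X W : Type*} [MeasurableSpace X] [MeasurableSpace W]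
    (ν : ℕ → Measure X) [∀ n, IsProbabilityMeasure (ν n)] (N : Measure W)
    [IsProbabilityMeasure N] {s : X × W → X} (hs : Measurable s) (n : ℕ) :
    ((cesaroMeasure ν n).prod N).map s = cesaroMeasure (fun k => ((ν k).prod N).map s) n := by
  ext A hA
  rw [Measure.map_apply hs hA, cesaroMeasure_apply, Measure.prod_apply (hs hA), cesaroMeasure,
    lintegral_smul_measure, lintegral_finsetSum_measure, smul_eq_mul]
  congr 1
  refine Finset.sum_congr rfl fun k _ => ?_
  rw [Measure.map_apply hs hA, Measure.prod_apply (hs hA)]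

theorem integral_cesaroMeasure {X : Type*} [MeasurableSpace X] (ν : ℕ → Measure X) (n : ℕ)
    {g : X → ℝ} (hg : ∀ k, Integrable g (ν k)) :
    ∫ x, g x ∂(cesaroMeasure ν n)
      = ((n : ℝ) + 1)⁻¹ * ∑ k ∈ Finset.range (n + 1), ∫ x, g x ∂(ν k) := by
  rw [cesaroMeasure, integral_smul_measure, integral_finsetSum_measure fun k _ => hg k,
    smul_eq_mul, ENNReal.toReal_inv]
  norm_cast

/-- Cesàro means of a sequence of probability measures and of the shifted sequence are
asymptotically equal when tested against bounded functions. -/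
theorem tendsto_integral_cesaroMeasure_sub {X : Type*} [MeasurableSpace X] (ν : ℕ → Measure X)
    [∀ n, IsProbabilityMeasure (ν n)] {g : X → ℝ} (hg : Measurable g) {c : ℝ}
    (hc : ∀ x, ‖g x‖ ≤ c) :
    Filter.Tendsto (fun n => ∫ x, g x ∂(cesaroMeasure ν n)
      - ∫ x, g x ∂(cesaroMeasure (fun k => ν (k + 1)) n)) Filter.atTop (nhds 0) := by
  have hint : ∀ k, Integrable g (ν k) := fun k =>
    Integrable.of_bound hg.aestronglyMeasurable c (Filter.Eventually.of_forall hc)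
  have hle : ∀ k, ‖∫ x, g x ∂(ν k)‖ ≤ c := fun k => by
    simpa using norm_integral_le_of_norm_le_const (μ := ν k) (Filter.Eventually.of_forall hc)
  -- The sum telescopes, leaving two boundary terms divided by n + 1.
  have heq : ∀ n : ℕ, ∫ x, g x ∂(cesaroMeasure ν n)
      - ∫ x, g x ∂(cesaroMeasure (fun k => ν (k + 1)) n)
      = ((n : ℝ) + 1)⁻¹ * (∫ x, g x ∂(ν 0) - ∫ x, g x ∂(ν (n + 1))) := by
    intro n
    rw [integral_cesaroMeasure ν n hint, integral_cesaroMeasure _ n fun k => hint (k + 1),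
      ← mul_sub, ← Finset.sum_sub_distrib, Finset.sum_range_sub' (fun k => ∫ x, g x ∂(ν k))]
  simp_rw [heq]
  have hlim : Filter.Tendsto (fun n : ℕ => ((n : ℝ) + 1)⁻¹ * (c + c)) Filter.atTop (nhds 0) := by
    have := (tendsto_one_div_add_atTop_nhds_zero_nat (𝕜 := ℝ)).mul_const (c + c)
    simpa using this
  refine squeeze_zero_norm (fun n => ?_) hlim
  rw [norm_mul, norm_inv, Real.norm_of_nonneg (by positivity : (0 : ℝ) ≤ (n : ℝ) + 1)]
  gcongr
  exact (norm_sub_le _ _).trans (add_le_add (hle _) (hle _))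

theorem ae_mem_iUnion_of_forall_measure_compl_le {Ω : Type*} [MeasurableSpace Ω] {μ : Measure Ω}
    {C : ℕ → Set Ω} (h : ∀ ε : ENNReal, 0 < ε → ∃ k, μ (C k)ᶜ ≤ ε) :
    ∀ᵐ x ∂μ, ∃ k, x ∈ C k := by
  rw [ae_iff]
  refine le_antisymm (le_of_forall_pos_le_add fun ε hε => ?_) (zero_le)
  obtain ⟨k, hk⟩ := h ε hε
  rw [zero_add]
  refine (measure_mono fun x hx => ?_).trans hk
  exact fun hxk => hx ⟨k, hxk⟩

/-- Portmanteau for the open complement. It transfers tightness bounds to the limit and, with ε = 0,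
support in a closed relation. -/
theorem measure_compl_le_of_tendsto {Ω ι : Type*} {L : Filter ι} [L.NeBot] [MeasurableSpace Ω]
    [TopologicalSpace Ω] [OpensMeasurableSpace Ω] [HasOuterApproxClosed Ω]
    {μ : ProbabilityMeasure Ω} {μs : ι → ProbabilityMeasure Ω}
    (h : Filter.Tendsto μs L (nhds μ)) {F : Set Ω} (hF : IsClosed F) {ε : ENNReal}
    (hle : ∀ i, (μs i : Measure Ω) Fᶜ ≤ ε) : (μ : Measure Ω) Fᶜ ≤ ε := by
  refine (ProbabilityMeasure.le_liminf_measure_open_of_tendsto h hF.isOpen_compl).trans ?_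
  refine Filter.liminf_le_of_le (by isBoundedDefault) fun b hb => ?_
  obtain ⟨i, hi⟩ := hb.exists
  exact hi.trans (hle i)

/-- Krylov–Bogoliubov for a random closed relation. The Markov chain `ν` on `X` is driven by a
measurable selection `s` of a relation that is closed for the topology of `Y`, into which `X` embeds
measurably, and it is tight for that topology. Then some Markov kernel carried by the relation has
an invariant measure. -/
theorem exists_invariant_of_isClosed_relation {X Y W : Type*}
    [MeasurableSpace X] [StandardBorelSpace X] [Nonempty X]
    [TopologicalSpace Y] [PolishSpace Y] [MeasurableSpace Y] [BorelSpace Y]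
    [TopologicalSpace W] [PolishSpace W] [MeasurableSpace W] [BorelSpace W]
    {ι : X → Y} (hι : MeasurableEmbedding ι) (N : Measure W) [IsProbabilityMeasure N]
    {R : Set ((Y × W) × Y)} (hR : IsClosed R) {s : X × W → X} (hs : Measurable s)
    (hsR : ∀ z : X × W, ((ι z.1, z.2), ι (s z)) ∈ R)
    {C : ℕ → Set Y} (hC : ∀ k, IsCompact (C k)) (hCι : ∀ k, C k ⊆ Set.range ι)
    (ν : ℕ → Measure X) [∀ n, IsProbabilityMeasure (ν n)]
    (hν : ∀ n, ν (n + 1) = ((ν n).prod N).map s)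
    (htight : ∀ ε : ENNReal, 0 < ε → ∃ k, ∀ n, ν n (ι ⁻¹' (C k))ᶜ ≤ ε) :
    ∃ K : Kernel (X × W) X, IsMarkovKernel K ∧
      (∀ z : X × W, ∀ᵐ y ∂(K z), ((ι z.1, z.2), ι y) ∈ R) ∧
      ∃ μ : Measure X, IsProbabilityMeasure μ ∧ (μ.prod N).bind K = μ := by
  have hιm := hι.measurable
  set J : X × W → (Y × W) × Y := fun z => ((ι z.1, z.2), ι (s z)) with hJ
  have hJm : Measurable J := by fun_prop
  set a : ℕ → Measure X := cesaroMeasure ν with ha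
  set b : ℕ → Measure X := cesaroMeasure (fun k => ν (k + 1)) with hb
  have hab : ∀ n, ((a n).prod N).map s = b n := by
    intro n
    rw [ha, map_prod_cesaroMeasure ν N hs, hb]
    simp_rw [hν]
  have hprob : ∀ n, IsProbabilityMeasure (((a n).prod N).map J) := fun n =>
    Measure.isProbabilityMeasure_map hJm.aemeasurable
  -- Compactness is applied to the joint laws of old state, increment and new state: their limits
  -- remember the relation even if `s` is discontinuous.
  let P : ℕ → ProbabilityMeasure ((Y × W) × Y) := fun n => ⟨((a n).prod N).map J, hprob n⟩
  have hPtight : IsTightMeasureSet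
      {((μ : ProbabilityMeasure ((Y × W) × Y)) : Measure ((Y × W) × Y)) | μ ∈ Set.range P} := by
    rw [isTightMeasureSet_iff_exists_isCompact_measure_compl_le]
    intro ε hε
    obtain ⟨k, hk⟩ := htight (ε / 3) (ENNReal.div_pos hε.ne' (by norm_num))
    obtain ⟨D, hD, hND⟩ := isTightMeasureSet_iff_exists_isCompact_measure_compl_le.1
      (isTightMeasureSet_singleton (μ := N)) (ε / 3) (ENNReal.div_pos hε.ne' (by norm_num))
    refine ⟨(C k ×ˢ D) ×ˢ C k, ((hC k).prod hD).prod (hC k), ?_⟩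
    rintro _ ⟨_, ⟨n, rfl⟩, rfl⟩
    have hCm : MeasurableSet (C k) := (hC k).isClosed.measurableSet
    have hDm : MeasurableSet D := hD.isClosed.measurableSet
    change ((a n).prod N).map J _ ≤ ε
    rw [Measure.map_apply hJm ((hCm.prod hDm).prod hCm).compl]
    calc ((a n).prod N) (J ⁻¹' ((C k ×ˢ D) ×ˢ C k)ᶜ)
        ≤ ((a n).prod N) ((ι ⁻¹' (C k))ᶜ ×ˢ Set.univ ∪ Set.univ ×ˢ Dᶜ ∪
            s ⁻¹' (ι ⁻¹' (C k))ᶜ) := by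
          refine measure_mono fun z hz => ?_
          simp only [hJ, Set.mem_preimage, Set.mem_compl_iff, Set.mem_prod, Set.mem_union,
            Set.mem_univ, and_true, true_and] at hz ⊢
          tauto
      _ ≤ a n (ι ⁻¹' (C k))ᶜ + N Dᶜ + b n (ι ⁻¹' (C k))ᶜ := by
          refine (measure_union_le _ _).trans (add_le_add ((measure_union_le _ _).trans ?_) ?_)
          · simp [Measure.prod_prod]
          · rw [← hab, Measure.map_apply hs (hιm hCm).compl]
      _ ≤ ε / 3 + ε / 3 + ε / 3 := by
          gcongr
          · exact cesaroMeasure_le hk n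
          · exact hND N rfl
          · exact cesaroMeasure_le (fun m => hk (m + 1)) n
      _ = ε := ENNReal.add_thirds ε
  have hcpt := isCompact_closure_of_isTightMeasureSet hPtight
  -- A limit along a nonprincipal ultrafilter takes the place of a subsequence.
  obtain ⟨Q, -, hQ⟩ := hcpt.ultrafilter_le_nhds' ((Filter.hyperfilter ℕ).map P)
    (Filter.mem_map.2 (Filter.univ_mem' fun n => subset_closure ⟨n, rfl⟩))
  have hPQ : Filter.Tendsto P (Filter.hyperfilter ℕ : Filter ℕ) (nhds Q) := hQ
  have hRQ : ∀ᵐ z ∂(Q : Measure ((Y × W) × Y)), z ∈ R := by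
    have h : (Q : Measure ((Y × W) × Y)) Rᶜ ≤ 0 := by
      refine measure_compl_le_of_tendsto hPQ hR fun n => ?_
      change ((a n).prod N).map J _ ≤ 0
      rw [Measure.map_apply hJm hR.measurableSet.compl]
      have : J ⁻¹' Rᶜ = ∅ := by
        ext z; simpa using hsR z
      rw [this, measure_empty]
    exact le_antisymm h (zero_le)
  have hc1 : Continuous fun z : (Y × W) × Y => z.1.1 := by fun_prop
  have hc2 : Continuous fun z : (Y × W) × Y => z.1 := by fun_prop
  have hc3 : Continuous fun z : (Y × W) × Y => z.2 := by fun_prop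
  have h1 := ProbabilityMeasure.tendsto_map_of_tendsto_of_continuous P Q hPQ hc1
  have h2 := ProbabilityMeasure.tendsto_map_of_tendsto_of_continuous P Q hPQ hc2
  have h3 := ProbabilityMeasure.tendsto_map_of_tendsto_of_continuous P Q hPQ hc3
  have hP1 : ∀ n, ((P n).map hc1.measurable.aemeasurable : Measure Y) = (a n).map ι := by
    intro n
    change (((a n).prod N).map J).map _ = _
    rw [Measure.map_map hc1.measurable hJm]
    change ((a n).prod N).map (ι ∘ Prod.fst) = _
    rw [← Measure.map_map hιm measurable_fst, Measure.map_fst_prod, measure_univ, one_smul]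
  have hP3 : ∀ n, ((P n).map hc3.measurable.aemeasurable : Measure Y) = (b n).map ι := by
    intro n
    change (((a n).prod N).map J).map _ = _
    rw [Measure.map_map hc3.measurable hJm, ← hab, Measure.map_map hιm hs]
    rfl
  let N' : ProbabilityMeasure W := ⟨N, inferInstance⟩
  -- Independence of old state and increment survives, because products of laws are weakly
  -- continuous.
  have hQ12 : Q.map hc2.measurable.aemeasurable
      = (Q.map hc1.measurable.aemeasurable).prod N' := by
    refine tendsto_nhds_unique h2 ?_
    have h := (ProbabilityMeasure.continuous_prod (α := Y) (β := W)).continuousAt.tendsto.comp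
      (h1.prodMk_nhds (tendsto_const_nhds (x := N')))
    refine h.congr fun n => ?_
    apply Subtype.ext
    change ((P n).map hc1.measurable.aemeasurable : Measure Y).prod N
      = (((a n).prod N).map J).map _
    rw [hP1, Measure.map_map hc2.measurable hJm]
    have : ((a n).map ι).prod N = ((a n).map ι).prod (N.map id) := by rw [Measure.map_id]
    rw [this, Measure.map_prod_map _ _ hιm measurable_id]
    rfl
  -- The two marginals are limits of Cesàro means of the chain and of its shift.
  have hQ13 : Q.map hc1.measurable.aemeasurable = Q.map hc3.measurable.aemeasurable := by
    suffices h : (Q.map hc1.measurable.aemeasurable : Measure Y)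
        = (Q.map hc3.measurable.aemeasurable : Measure Y) from Subtype.ext h
    refine ext_of_forall_integral_eq_of_IsFiniteMeasure fun g => ?_
    have e1 := (ProbabilityMeasure.tendsto_iff_forall_integral_tendsto.1 h1) g
    have e3 := (ProbabilityMeasure.tendsto_iff_forall_integral_tendsto.1 h3) g
    have hlim := (tendsto_integral_cesaroMeasure_sub ν (g.continuous.measurable.comp hιm)
      (fun x => g.norm_coe_le_norm (ι x))).mono_left Nat.hyperfilter_le_atTop
    have hgm : ∀ m : Measure Y, AEStronglyMeasurable g m := fun m =>
      g.continuous.measurable.aestronglyMeasurable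
    have := tendsto_nhds_unique (e1.sub e3) (hlim.congr fun n => ?_)
    · exact sub_eq_zero.1 this
    · rw [hP1, hP3, integral_map hιm.aemeasurable (hgm _),
        integral_map hιm.aemeasurable (hgm _)]
      rfl
  -- The limit is a law on `Y`; the compact sets `C k` inside the range of `ι` bring it back to `X`.
  have hran1 : ∀ᵐ z ∂(Q : Measure ((Y × W) × Y)), z.1.1 ∈ Set.range ι := by
    have h : ∀ᵐ y ∂(Q.map hc1.measurable.aemeasurable : Measure Y), ∃ k, y ∈ C k := by
      refine ae_mem_iUnion_of_forall_measure_compl_le fun ε hε => ?_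
      obtain ⟨k, hk⟩ := htight ε hε
      refine ⟨k, measure_compl_le_of_tendsto h1 (hC k).isClosed fun n => ?_⟩
      rw [hP1, Measure.map_apply hιm (hC k).isClosed.measurableSet.compl]
      exact cesaroMeasure_le hk n
    filter_upwards [ae_of_ae_map hc1.measurable.aemeasurable h] with z ⟨k, hz⟩ using hCι k hz
  have hran3 : ∀ᵐ z ∂(Q : Measure ((Y × W) × Y)), z.2 ∈ Set.range ι := by
    have h : ∀ᵐ y ∂(Q.map hc3.measurable.aemeasurable : Measure Y), y ∈ Set.range ι := by
      rw [← hQ13]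
      exact (ae_map_iff hc1.measurable.aemeasurable hι.measurableSet_range).2 hran1
    exact ae_of_ae_map hc3.measurable.aemeasurable h
  set e : Y → X := hι.invFun with he
  have hem : Measurable e := hι.measurable_invFun
  have hιe : ∀ y ∈ Set.range ι, ι (e y) = y := by
    rintro _ ⟨x, rfl⟩
    rw [he, hι.leftInverse_invFun x]
  set H : (Y × W) × Y → (X × W) × X := fun z => ((e z.1.1, z.1.2), e z.2) with hH
  have hHm : Measurable H := by fun_prop
  set ρ : Measure ((X × W) × X) := (Q : Measure ((Y × W) × Y)).map H with hρ
  have hρp : IsProbabilityMeasure ρ := Measure.isProbabilityMeasure_map hHm.aemeasurable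
  set T : Set ((X × W) × X) := {z | ((ι z.1.1, z.1.2), ι z.2) ∈ R} with hT
  have hTm : MeasurableSet T :=
    (by fun_prop : Measurable fun z : (X × W) × X => ((ι z.1.1, z.1.2), ι z.2)) hR.measurableSet
  have hρT : ∀ᵐ z ∂ρ, z ∈ T := by
    refine (ae_map_iff hHm.aemeasurable hTm).2 ?_
    filter_upwards [hRQ, hran1, hran3] with z hz hz1 hz3
    change ((ι (e z.1.1), z.1.2), ι (e z.2)) ∈ R
    rwa [hιe _ hz1, hιe _ hz3]
  obtain ⟨K, hK, hKT, hKρ⟩ := exists_markovKernel_of_ae_mem ρ hTm hρT hs hsR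
  set μ : Measure X := (Q.map hc1.measurable.aemeasurable : Measure Y).map e with hμ
  refine ⟨K, hK, hKT, μ, Measure.isProbabilityMeasure_map hem.aemeasurable, ?_⟩
  have hfst : ρ.fst = μ.prod N := by
    have h : (Q : Measure ((Y × W) × Y)).map (fun z => z.1)
        = (Q.map hc1.measurable.aemeasurable : Measure Y).prod N := congrArg Subtype.val hQ12
    have hN : μ.prod N = μ.prod (N.map id) := by rw [Measure.map_id]
    rw [hN, hμ, Measure.map_prod_map _ _ hem measurable_id, ← h,
      Measure.map_map (hem.prodMap measurable_id) hc2.measurable, Measure.fst, hρ,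
      Measure.map_map measurable_fst hHm]
    rfl
  have hsnd : ρ.snd = μ := by
    rw [hμ, hQ13, Measure.snd, hρ, Measure.map_map measurable_snd hHm]
    change _ = ((Q : Measure ((Y × W) × Y)).map (fun z => z.2)).map e
    rw [Measure.map_map hem hc3.measurable]
    rfl
  rw [← hfst, hKρ, hsnd]

/-! ### Dissipativity and solvability of the implicit equations. -/

/-- The negative discrete Laplacian on arbitrary sequences. -/
def latticeLaplacian (u : ℤ → ℝ) (i : ℤ) : ℝ := -u (i - 1) + 2 * u i - u (i + 1)

theorem Finset.sum_le_sum_of_eq_zero_of_notMem {ι : Type*} {I J : Finset ι} {f : ι → ℝ}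
    (hf : ∀ i, 0 ≤ f i) (h0 : ∀ i ∉ J, f i = 0) : ∑ i ∈ I, f i ≤ ∑ i ∈ J, f i := by
  classical
  rw [Finset.sum_subset (Finset.subset_union_right (s₁ := I) (s₂ := J)) fun i _ hi => h0 i hi]
  exact Finset.sum_le_sum_of_subset_of_nonneg Finset.subset_union_left fun i _ _ => hf i

/-- Sitewise, u_i (Au)_i ≥ u_i² − (u_{i+1}² + u_{i−1}²)/2, and shifting a sequence supported in `J`
cannot increase its sum of squares over `J`. -/
theorem sum_mul_latticeLaplacian_nonneg {J : Finset ℤ} {u : ℤ → ℝ} (hu : ∀ i ∉ J, u i = 0) :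
    0 ≤ ∑ i ∈ J, u i * latticeLaplacian u i := by
  have hshift : ∀ e : ℤ ↪ ℤ, ∑ i ∈ J, u (e i) ^ 2 ≤ ∑ i ∈ J, u i ^ 2 := by
    intro e
    rw [← Finset.sum_map J e fun i => u i ^ 2]
    exact Finset.sum_le_sum_of_eq_zero_of_notMem (fun i => sq_nonneg _) fun i h => by simp [hu i h]
  have h1 := hshift (Equiv.addRight (1 : ℤ)).toEmbedding
  have h2 := hshift (Equiv.subRight (1 : ℤ)).toEmbedding
  simp only [Equiv.coe_toEmbedding, Equiv.coe_addRight, Equiv.subRight_apply] at h1 h2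
  have h3 : ∑ i ∈ J, (u i ^ 2 - (u (i + 1) ^ 2 + u (i - 1) ^ 2) / 2)
      ≤ ∑ i ∈ J, u i * latticeLaplacian u i := by
    refine Finset.sum_le_sum fun i _ => ?_
    unfold latticeLaplacian
    nlinarith [sq_nonneg (u i - u (i + 1)), sq_nonneg (u i - u (i - 1))]
  rw [Finset.sum_sub_distrib, ← Finset.sum_div, Finset.sum_add_distrib] at h3
  linarith

namespace SelkovData

/-- The residual of the first implicit equation with right-hand side `ξ`. -/
def residualU (S : SelkovData) (Δ : ℝ) (ξ u v : ℤ → ℝ) (i : ℤ) : ℝ :=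
  u i + (S.d₁ * latticeLaplacian u i + S.a₁ * u i - S.b₁ * (u i ^ (2 * S.p) * v i)
    + S.b₂ * u i ^ (2 * S.p + 1)) * Δ - ξ i

/-- The residual of the second implicit equation with right-hand side `η`. -/
def residualV (S : SelkovData) (Δ : ℝ) (η u v : ℤ → ℝ) (i : ℤ) : ℝ :=
  v i + (S.d₂ * latticeLaplacian v i + S.a₂ * v i + S.b₁ * (u i ^ (2 * S.p) * v i)
    - S.b₂ * u i ^ (2 * S.p + 1)) * Δ - η i

/-- The energy `b₂ s² + b₁ t²` of a pair of reals, which makes the reaction terms dissipative. -/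
def siteEnergy (S : SelkovData) (s t : ℝ) : ℝ := S.b₂ * s ^ 2 + S.b₁ * t ^ 2

/-- The positivity conditions on the constants of the system. -/
structure Admissible (S : SelkovData) : Prop where
  d₁_pos : 0 < S.d₁
  d₂_pos : 0 < S.d₂
  a₁_pos : 0 < S.a₁
  a₂_pos : 0 < S.a₂
  b₁_pos : 0 < S.b₁
  b₂_pos : 0 < S.b₂

variable {S : SelkovData}

theorem siteEnergy_nonneg (hS : S.Admissible) (s t : ℝ) : 0 ≤ S.siteEnergy s t := by
  have := hS.b₁_pos
  have := hS.b₂_pos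
  unfold siteEnergy
  positivity

/-- Energy inequality for finitely supported states. -/
theorem energy_le_sum_residual (hS : S.Admissible) {Δ : ℝ} (hΔ : 0 < Δ) {ξ η u v : ℤ → ℝ}
    {J : Finset ℤ} (hu : ∀ i ∉ J, u i = 0) (hv : ∀ i ∉ J, v i = 0) :
    (1 + min S.a₁ S.a₂ * Δ) * ∑ i ∈ J, S.siteEnergy (u i) (v i)
        - ∑ i ∈ J, (S.b₂ * (u i * ξ i) + S.b₁ * (v i * η i))
      ≤ ∑ i ∈ J, (S.b₂ * (u i * S.residualU Δ ξ u v i) + S.b₁ * (v i * S.residualV Δ η u v i)) := by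
  have h1 := sum_mul_latticeLaplacian_nonneg hu
  have h2 := sum_mul_latticeLaplacian_nonneg hv
  have hb1 := hS.b₁_pos
  have hb2 := hS.b₂_pos
  have h3 : 0 ≤ Δ * (S.b₂ * S.d₁ * ∑ i ∈ J, u i * latticeLaplacian u i
      + S.b₁ * S.d₂ * ∑ i ∈ J, v i * latticeLaplacian v i) := by
    have := hS.d₁_pos
    have := hS.d₂_pos
    positivity
  have h4 : (1 + min S.a₁ S.a₂ * Δ) * ∑ i ∈ J, S.siteEnergy (u i) (v i)
        - ∑ i ∈ J, (S.b₂ * (u i * ξ i) + S.b₁ * (v i * η i))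
      ≤ ∑ i ∈ J, (S.b₂ * (u i * S.residualU Δ ξ u v i) + S.b₁ * (v i * S.residualV Δ η u v i)
        - Δ * (S.b₂ * S.d₁ * (u i * latticeLaplacian u i)
          + S.b₁ * S.d₂ * (v i * latticeLaplacian v i))) := by
    rw [Finset.mul_sum, ← Finset.sum_sub_distrib]
    refine Finset.sum_le_sum fun i _ => ?_
    -- This square is exactly the weighted sum of the four reaction terms.
    have e1 : 0 ≤ Δ * (u i ^ (2 * S.p) * (S.b₂ * u i - S.b₁ * v i) ^ 2) := by
      have : 0 ≤ u i ^ (2 * S.p) := by rw [pow_mul]; positivity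
      positivity
    have e2 : 0 ≤ (S.a₁ - min S.a₁ S.a₂) * (Δ * (S.b₂ * u i ^ 2)) :=
      mul_nonneg (sub_nonneg.2 (min_le_left _ _)) (by positivity)
    have e3 : 0 ≤ (S.a₂ - min S.a₁ S.a₂) * (Δ * (S.b₁ * v i ^ 2)) :=
      mul_nonneg (sub_nonneg.2 (min_le_right _ _)) (by positivity)
    have e4 : S.b₂ * (u i * S.residualU Δ ξ u v i) + S.b₁ * (v i * S.residualV Δ η u v i)
      - Δ * (S.b₂ * S.d₁ * (u i * latticeLaplacian u i)
        + S.b₁ * S.d₂ * (v i * latticeLaplacian v i))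
      - ((1 + min S.a₁ S.a₂ * Δ) * S.siteEnergy (u i) (v i)
        - (S.b₂ * (u i * ξ i) + S.b₁ * (v i * η i)))
      = Δ * (u i ^ (2 * S.p) * (S.b₂ * u i - S.b₁ * v i) ^ 2)
        + (S.a₁ - min S.a₁ S.a₂) * (Δ * (S.b₂ * u i ^ 2))
        + (S.a₂ - min S.a₁ S.a₂) * (Δ * (S.b₁ * v i ^ 2)) := by
      unfold residualU residualV siteEnergy
      rw [pow_succ]
      ring
    linarith
  rw [Finset.sum_sub_distrib, ← Finset.mul_sum, Finset.sum_add_distrib (f := fun i =>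
    S.b₂ * S.d₁ * (u i * latticeLaplacian u i)), ← Finset.mul_sum, ← Finset.mul_sum] at h4
  linarith

/-- The implicit equations truncated to a finite set of sites are solvable. -/
theorem exists_truncated_solution (hS : S.Admissible) {Δ : ℝ} (hΔ : 0 < Δ) (ξ η : ℤ → ℝ)
    (J : Finset ℤ) : ∃ u v : ℤ → ℝ, (∀ i ∉ J, u i = 0) ∧ (∀ i ∉ J, v i = 0) ∧
      (∀ i ∈ J, S.residualU Δ ξ u v i = 0) ∧ (∀ i ∈ J, S.residualV Δ η u v i = 0) ∧
      (1 + min S.a₁ S.a₂ * Δ) ^ 2 * ∑ i ∈ J, S.siteEnergy (u i) (v i)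
        ≤ ∑ i ∈ J, S.siteEnergy (ξ i) (η i) := by
  classical
  have hb1 := hS.b₁_pos
  have hb2 := hS.b₂_pos
  have ha : 0 < min S.a₁ S.a₂ := lt_min hS.a₁_pos hS.a₂_pos
  set c := 1 + min S.a₁ S.a₂ * Δ with hc
  have hc1 : 1 ≤ c := by
    have := mul_pos ha hΔ
    linarith
  let U : EuclideanSpace ℝ (J ⊕ J) → ℤ → ℝ := fun y i => if h : i ∈ J then y (Sum.inl ⟨i, h⟩) else 0
  let V : EuclideanSpace ℝ (J ⊕ J) → ℤ → ℝ := fun y i => if h : i ∈ J then y (Sum.inr ⟨i, h⟩) else 0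
  have hUJ : ∀ (y : EuclideanSpace ℝ (J ⊕ J)) (i : J), y (Sum.inl i) = U y i := fun y i => by simp [U]
  have hVJ : ∀ (y : EuclideanSpace ℝ (J ⊕ J)) (i : J), y (Sum.inr i) = V y i := fun y i => by simp [V]
  have hU0 : ∀ y, ∀ i ∉ J, U y i = 0 := fun y i hi => by simp [U, hi]
  have hV0 : ∀ y, ∀ i ∉ J, V y i = 0 := fun y i hi => by simp [V, hi]
  -- The weights b₂ and b₁ make ⟨Φ y, y⟩ the right-hand side of the energy inequality.
  let Φ : EuclideanSpace ℝ (J ⊕ J) → EuclideanSpace ℝ (J ⊕ J) := fun y => WithLp.toLp 2 (Sum.elim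
    (fun i : J => S.b₂ * S.residualU Δ ξ (U y) (V y) i)
    (fun i : J => S.b₁ * S.residualV Δ η (U y) (V y) i))
  have hinner : ∀ y, inner ℝ (Φ y) y = ∑ i ∈ J, (S.b₂ * (U y i * S.residualU Δ ξ (U y) (V y) i)
      + S.b₁ * (V y i * S.residualV Δ η (U y) (V y) i)) := by
    intro y
    rw [PiLp.inner_apply, Fintype.sum_sum_type, Finset.sum_add_distrib, ← Finset.sum_coe_sort J,
      ← Finset.sum_coe_sort J]
    congr 1 <;> refine Finset.sum_congr rfl fun i _ => ?_
    · simp only [Φ, Sum.elim_inl, hUJ, RCLike.inner_apply, conj_trivial]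
      ring
    · simp only [Φ, Sum.elim_inr, hVJ, RCLike.inner_apply, conj_trivial]
      ring
  have hnorm : ∀ y : EuclideanSpace ℝ (J ⊕ J), ‖y‖ ^ 2 = ∑ i ∈ J, (U y i ^ 2 + V y i ^ 2) := by
    intro y
    rw [EuclideanSpace.norm_sq_eq, Fintype.sum_sum_type, Finset.sum_add_distrib,
      ← Finset.sum_coe_sort J, ← Finset.sum_coe_sort J]
    simp [hUJ, hVJ]
  have hsmooth : ContDiff ℝ 1 Φ := by
    have hUs : ∀ i, ContDiff ℝ 1 fun y : EuclideanSpace ℝ (J ⊕ J) => U y i := by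
      intro i
      by_cases hi : i ∈ J
      · simp only [U, hi, dite_true]
        fun_prop
      · simp only [U, hi, dite_false]
        exact contDiff_const
    have hVs : ∀ i, ContDiff ℝ 1 fun y : EuclideanSpace ℝ (J ⊕ J) => V y i := by
      intro i
      by_cases hi : i ∈ J
      · simp only [V, hi, dite_true]
        fun_prop
      · simp only [V, hi, dite_false]
        exact contDiff_const
    rw [contDiff_euclidean]
    rintro (i | i)
    · simp only [Φ, Sum.elim_inl, residualU, latticeLaplacian]
      fun_prop
    · simp only [Φ, Sum.elim_inr, residualV, latticeLaplacian]
      fun_prop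
  set M := ∑ i ∈ J, S.siteEnergy (ξ i) (η i) with hM
  have hM0 : 0 ≤ M := Finset.sum_nonneg fun i _ => siteEnergy_nonneg hS _ _
  set m := min S.b₁ S.b₂ with hm
  have hm0 : 0 < m := lt_min hb1 hb2
  -- At this radius q ≥ M + 1, hence ⟨Φ y, y⟩ ≥ c q − (q + M)/2 > 0.
  have hpos : ∀ y : EuclideanSpace ℝ (J ⊕ J), ‖y‖ = √((M + 1) / m) → 0 < inner ℝ (Φ y) y := by
    intro y hy
    rw [hinner]
    refine lt_of_lt_of_le ?_ (energy_le_sum_residual hS hΔ (hU0 y) (hV0 y))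
    set q := ∑ i ∈ J, S.siteEnergy (U y i) (V y i) with hq
    have h1 : m * ‖y‖ ^ 2 ≤ q := by
      rw [hnorm, Finset.mul_sum]
      refine Finset.sum_le_sum fun i _ => ?_
      have e1 := mul_le_mul_of_nonneg_right (min_le_right S.b₁ S.b₂) (sq_nonneg (U y i))
      have e2 := mul_le_mul_of_nonneg_right (min_le_left S.b₁ S.b₂) (sq_nonneg (V y i))
      unfold siteEnergy
      linarith
    have h2 : m * ‖y‖ ^ 2 = M + 1 := by
      rw [hy, Real.sq_sqrt (by positivity)]
      field_simp
    have h3 : ∑ i ∈ J, (S.b₂ * (U y i * ξ i) + S.b₁ * (V y i * η i)) ≤ (q + M) / 2 := by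
      rw [hq, hM, ← Finset.sum_add_distrib, Finset.sum_div]
      refine Finset.sum_le_sum fun i _ => ?_
      have e1 := mul_nonneg hb2.le (sq_nonneg (U y i - ξ i))
      have e2 := mul_nonneg hb1.le (sq_nonneg (V y i - η i))
      unfold siteEnergy
      linarith
    have h4 : q ≤ c * q := le_mul_of_one_le_left (by linarith) hc1
    linarith
  obtain ⟨y, -, hy⟩ := exists_zero_of_inner_pos
    (Real.sqrt_pos.2 (by positivity : 0 < (M + 1) / m)) hsmooth hpos
  refine ⟨U y, V y, hU0 y, hV0 y, fun i hi => ?_, fun i hi => ?_, ?_⟩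
  · have h : Φ y (Sum.inl ⟨i, hi⟩) = 0 := by rw [hy]; rfl
    exact (mul_eq_zero.1 h).resolve_left hb2.ne'
  · have h : Φ y (Sum.inr ⟨i, hi⟩) = 0 := by rw [hy]; rfl
    exact (mul_eq_zero.1 h).resolve_left hb1.ne'
  · have h := energy_le_sum_residual hS hΔ (ξ := ξ) (η := η) (hU0 y) (hV0 y)
    rw [← hinner, hy, inner_zero_left, ← hc] at h
    set q := ∑ i ∈ J, S.siteEnergy (U y i) (V y i) with hq
    -- Young's inequality with weight c: together with the energy inequality at a zero of `Φ` it
    -- gives 2c²q ≤ c²q + M.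
    have h3 : 2 * c * ∑ i ∈ J, (S.b₂ * (U y i * ξ i) + S.b₁ * (V y i * η i)) ≤ c ^ 2 * q + M := by
      rw [hq, hM, Finset.mul_sum, Finset.mul_sum, ← Finset.sum_add_distrib]
      refine Finset.sum_le_sum fun i _ => ?_
      have e1 := mul_nonneg hb2.le (sq_nonneg (c * U y i - ξ i))
      have e2 := mul_nonneg hb1.le (sq_nonneg (c * V y i - η i))
      unfold siteEnergy
      linarith
    have h5 := mul_le_mul_of_nonneg_left h (by linarith : 0 ≤ 2 * c)
    linarith

/-- The implicit equations are solvable on the whole lattice, with an energy bound. -/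
theorem exists_solution (hS : S.Admissible) {Δ : ℝ} (hΔ : 0 < Δ) (ξ η : ℤ → ℝ) {M : ℝ}
    (hM : ∀ J : Finset ℤ, ∑ i ∈ J, S.siteEnergy (ξ i) (η i) ≤ M) :
    ∃ u v : ℤ → ℝ, (∀ i, S.residualU Δ ξ u v i = 0) ∧ (∀ i, S.residualV Δ η u v i = 0) ∧
      ∀ J : Finset ℤ, (1 + min S.a₁ S.a₂ * Δ) ^ 2 * ∑ i ∈ J, S.siteEnergy (u i) (v i) ≤ M := by
  have hb1 := hS.b₁_pos
  have hb2 := hS.b₂_pos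
  have ha : 0 < min S.a₁ S.a₂ := lt_min hS.a₁_pos hS.a₂_pos
  set c := 1 + min S.a₁ S.a₂ * Δ with hc
  have hc1 : 1 ≤ c ^ 2 := by
    have := mul_pos ha hΔ
    exact one_le_pow₀ (by linarith)
  choose u v hu0 hv0 hu hv hq using fun n : ℕ =>
    exists_truncated_solution hS hΔ ξ η (Finset.Icc (-(n : ℤ)) n)
  rw [← hc] at hq
  have hsum : ∀ n (J : Finset ℤ), c ^ 2 * ∑ i ∈ J, S.siteEnergy (u n i) (v n i) ≤ M := by
    intro n J
    refine le_trans (mul_le_mul_of_nonneg_left ?_ (by positivity)) ((hq n).trans (hM _))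
    exact Finset.sum_le_sum_of_eq_zero_of_notMem (fun i => siteEnergy_nonneg hS _ _)
      fun i h => by simp [hu0 n i h, hv0 n i h, siteEnergy]
  have hsite : ∀ n i, S.b₂ * u n i ^ 2 + S.b₁ * v n i ^ 2 ≤ M := by
    intro n i
    have h := hsum n {i}
    rw [Finset.sum_singleton] at h
    exact (le_mul_of_one_le_left (siteEnergy_nonneg hS _ _) hc1).trans h
  set r := max (√(M / S.b₂)) (√(M / S.b₁)) with hr
  have hur : ∀ n i, u n i ∈ Set.Icc (-r) r := by
    intro n i
    rw [Set.mem_Icc, ← abs_le]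
    refine (Real.abs_le_sqrt ?_).trans (le_max_left _ _)
    rw [le_div_iff₀ hb2]
    have := mul_nonneg hb1.le (sq_nonneg (v n i))
    linarith [hsite n i]
  have hvr : ∀ n i, v n i ∈ Set.Icc (-r) r := by
    intro n i
    rw [Set.mem_Icc, ← abs_le]
    refine (Real.abs_le_sqrt ?_).trans (le_max_right _ _)
    rw [le_div_iff₀ hb1]
    have := mul_nonneg hb2.le (sq_nonneg (u n i))
    linarith [hsite n i]
  have hcpt : IsCompact (Set.univ.pi fun _ : ℤ => Set.Icc (-r) r) :=
    isCompact_univ_pi fun _ => isCompact_Icc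
  obtain ⟨⟨u', v'⟩, -, φ, hφ, hlim⟩ := (hcpt.prod hcpt).tendsto_subseq
    (x := fun n => (u n, v n)) fun n => ⟨fun i _ => hur n i, fun i _ => hvr n i⟩
  have hlu : ∀ i, Filter.Tendsto (fun n => u (φ n) i) Filter.atTop (nhds (u' i)) :=
    tendsto_pi_nhds.1 hlim.fst_nhds
  have hlv : ∀ i, Filter.Tendsto (fun n => v (φ n) i) Filter.atTop (nhds (v' i)) :=
    tendsto_pi_nhds.1 hlim.snd_nhds
  -- Each site eventually enters the window, and its equations involve only the site and its
  -- neighbours, so they pass to the coordinatewise limit.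
  have hmem : ∀ i : ℤ, ∀ᶠ n in Filter.atTop, i ∈ Finset.Icc (-(φ n : ℤ)) (φ n) := by
    intro i
    filter_upwards [Filter.eventually_ge_atTop i.natAbs] with n hn
    have := hφ.le_apply (x := n)
    rw [Finset.mem_Icc]
    omega
  refine ⟨u', v', fun i => ?_, fun i => ?_, fun J => ?_⟩
  · have h : Filter.Tendsto (fun n => S.residualU Δ ξ (u (φ n)) (v (φ n)) i) Filter.atTop
        (nhds (S.residualU Δ ξ u' v' i)) := by
      unfold residualU latticeLaplacian
      have e1 := hlu i
      have e2 := hlu (i - 1)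
      have e3 := hlu (i + 1)
      have e4 := hlv i
      exact (e1.add ((((((((e2.neg.add (e1.const_mul 2)).sub e3).const_mul _).add
        (e1.const_mul _)).sub (((e1.pow _).mul e4).const_mul _)).add
        ((e1.pow _).const_mul _))).mul_const _)).sub tendsto_const_nhds
    refine tendsto_nhds_unique h (tendsto_const_nhds.congr' ?_)
    filter_upwards [hmem i] with n hn using (hu (φ n) i hn).symm
  · have h : Filter.Tendsto (fun n => S.residualV Δ η (u (φ n)) (v (φ n)) i) Filter.atTop
        (nhds (S.residualV Δ η u' v' i)) := by
      unfold residualV latticeLaplacian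
      have e1 := hlv i
      have e2 := hlv (i - 1)
      have e3 := hlv (i + 1)
      have e4 := hlu i
      exact (e1.add ((((((((e2.neg.add (e1.const_mul 2)).sub e3).const_mul _).add
        (e1.const_mul _)).add (((e4.pow _).mul e1).const_mul _)).sub
        ((e4.pow _).const_mul _))).mul_const _)).sub tendsto_const_nhds
    refine tendsto_nhds_unique h (tendsto_const_nhds.congr' ?_)
    filter_upwards [hmem i] with n hn using (hv (φ n) i hn).symm
  · have h : Filter.Tendsto (fun n => c ^ 2 * ∑ i ∈ J, S.siteEnergy (u (φ n) i) (v (φ n) i))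
        Filter.atTop (nhds (c ^ 2 * ∑ i ∈ J, S.siteEnergy (u' i) (v' i))) :=
      (tendsto_finsetSum _ fun i _ => (((hlu i).pow 2).const_mul _).add
        (((hlv i).pow 2).const_mul _)).const_mul _
    exact le_of_tendsto' h fun n => hsum (φ n) J

end SelkovData

/-! ### The phase space and its coordinatewise topology. -/

instance secondCountableTopologyEll2 : SecondCountableTopology Ell2 := by
  have hsep : TopologicalSpace.IsSeparable (Set.univ : Set Ell2) := by
    have hspan : TopologicalSpace.IsSeparable
        ((Submodule.span ℝ (Set.range fun i : ℤ => lp.single 2 i (1 : ℝ)) : Set Ell2)) :=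
      (Set.countable_range _).isSeparable.span
    refine hspan.closure.mono fun x _ => ?_
    refine mem_closure_of_tendsto (lp.hasSum_single (by simp) x)
      (Filter.Eventually.of_forall fun J => Submodule.sum_mem _ fun i _ => ?_)
    have : lp.single 2 i (x i) = x i • (lp.single 2 i (1 : ℝ) : Ell2) := by
      rw [← lp.single_smul, smul_eq_mul, mul_one]
    rw [this]
    exact Submodule.smul_mem _ _ (Submodule.subset_span ⟨i, rfl⟩)
  have : TopologicalSpace.SeparableSpace Ell2 := TopologicalSpace.isSeparable_univ_iff.1 hsep
  exact UniformSpace.secondCountable_of_separable Ell2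

theorem Ell2.hasSum_sq (u : Ell2) : HasSum (fun i => u i ^ 2) (‖u‖ ^ 2) := by
  have := lp.hasSum_norm (p := 2) (by simp) u
  simpa using this

theorem Ell2.memℓp_of_sum_sq_le {u : ℤ → ℝ} {C : ℝ} (h : ∀ J : Finset ℤ, ∑ i ∈ J, u i ^ 2 ≤ C) :
    Memℓp u 2 :=
  memℓp_gen' (C := C) fun J => by simpa using h J

theorem Ell2.norm_sq_le_of_sq_le {u v : Ell2} {c : ℝ}
    (h : ∀ i, u i ^ 2 ≤ c * v i ^ 2) : ‖u‖ ^ 2 ≤ c * ‖v‖ ^ 2 :=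
  hasSum_le h (Ell2.hasSum_sq u) ((Ell2.hasSum_sq v).mul_left c)

theorem Ell2.continuous_apply (i : ℤ) : Continuous fun u : Ell2 => u i :=
  (lp.lipschitzWith_one_eval 2 i).continuous

/-- The coordinates of a state, as a pair of arbitrary sequences. -/
def stateCoords (x : PhaseSpace) : (ℤ → ℝ) × (ℤ → ℝ) := (fun i => x.1 i, fun i => x.2 i)

theorem continuous_stateCoords : Continuous stateCoords :=
  (continuous_pi fun i => (Ell2.continuous_apply i).comp continuous_fst).prodMk
    (continuous_pi fun i => (Ell2.continuous_apply i).comp continuous_snd)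

/-- By Lusin–Souslin, a continuous injection of a Polish space is a Borel embedding. The norm
topology can thus be traded for the coordinatewise one without changing measurability. -/
theorem measurableEmbedding_stateCoords : MeasurableEmbedding stateCoords := by
  refine continuous_stateCoords.measurableEmbedding fun x y h => ?_
  have h1 := congrArg Prod.fst h
  have h2 := congrArg Prod.snd h
  exact Prod.ext (lp.ext h1) (lp.ext h2)

namespace SelkovData

variable {S : SelkovData}

/-- The energy `b₂ ‖u‖² + b₁ ‖v‖²` of a state. -/
noncomputable def energy (S : SelkovData) (x : PhaseSpace) : ℝ := S.b₂ * ‖x.1‖ ^ 2 + S.b₁ * ‖x.2‖ ^ 2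

theorem energy_nonneg (hS : S.Admissible) (x : PhaseSpace) : 0 ≤ S.energy x := by
  have := hS.b₁_pos
  have := hS.b₂_pos
  unfold energy
  positivity

theorem continuous_energy : Continuous S.energy := by
  unfold energy
  fun_prop

theorem hasSum_siteEnergy (x : PhaseSpace) :
    HasSum (fun i => S.siteEnergy (x.1 i) (x.2 i)) (S.energy x) :=
  ((Ell2.hasSum_sq x.1).mul_left _).add ((Ell2.hasSum_sq x.2).mul_left _)

theorem sum_siteEnergy_le_energy (hS : S.Admissible) (x : PhaseSpace) (J : Finset ℤ) :
    ∑ i ∈ J, S.siteEnergy (x.1 i) (x.2 i) ≤ S.energy x :=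
  sum_le_hasSum J (fun _ _ => siteEnergy_nonneg hS _ _) (hasSum_siteEnergy x)

/-- Sequences of finite energy are the coordinates of a state. -/
theorem exists_state_of_sum_siteEnergy_le (hS : S.Admissible) {u v : ℤ → ℝ} {M : ℝ}
    (h : ∀ J : Finset ℤ, ∑ i ∈ J, S.siteEnergy (u i) (v i) ≤ M) :
    ∃ x : PhaseSpace, stateCoords x = (u, v) ∧ S.energy x ≤ M := by
  have hb1 := hS.b₁_pos
  have hb2 := hS.b₂_pos
  have hu : Memℓp u 2 := by
    refine Ell2.memℓp_of_sum_sq_le (C := M / S.b₂) fun J => ?_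
    rw [le_div_iff₀ hb2, mul_comm, Finset.mul_sum]
    refine (Finset.sum_le_sum fun i _ => ?_).trans (h J)
    exact le_add_of_nonneg_right (by positivity)
  have hv : Memℓp v 2 := by
    refine Ell2.memℓp_of_sum_sq_le (C := M / S.b₁) fun J => ?_
    rw [le_div_iff₀ hb1, mul_comm, Finset.mul_sum]
    refine (Finset.sum_le_sum fun i _ => ?_).trans (h J)
    exact le_add_of_nonneg_left (by positivity)
  exact ⟨(⟨u, hu⟩, ⟨v, hv⟩), rfl, hasSum_le_of_sum_le
    (hasSum_siteEnergy (S := S) (⟨u, hu⟩, ⟨v, hv⟩)) h⟩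

/-- The set of pairs of sequences of energy at most `M`. -/
def energySublevel (S : SelkovData) (M : ℝ) : Set ((ℤ → ℝ) × (ℤ → ℝ)) :=
  {y | ∀ J : Finset ℤ, ∑ i ∈ J, S.siteEnergy (y.1 i) (y.2 i) ≤ M}

theorem abs_le_of_siteEnergy_le (hS : S.Admissible) {s t M : ℝ} (h : S.siteEnergy s t ≤ M) :
    |s| ≤ max (√(M / S.b₂)) (√(M / S.b₁)) ∧ |t| ≤ max (√(M / S.b₂)) (√(M / S.b₁)) := by
  have hb1 := hS.b₁_pos
  have hb2 := hS.b₂_pos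
  unfold siteEnergy at h
  have e1 := mul_nonneg hb1.le (sq_nonneg t)
  have e2 := mul_nonneg hb2.le (sq_nonneg s)
  refine ⟨(Real.abs_le_sqrt ?_).trans (le_max_left _ _),
    (Real.abs_le_sqrt ?_).trans (le_max_right _ _)⟩
  · rw [le_div_iff₀ hb2]
    linarith
  · rw [le_div_iff₀ hb1]
    linarith

theorem abs_le_of_mem_energySublevel (hS : S.Admissible) {y : (ℤ → ℝ) × (ℤ → ℝ)} {M : ℝ}
    (h : y ∈ S.energySublevel M) (i : ℤ) :
    |y.1 i| ≤ max (√(M / S.b₂)) (√(M / S.b₁)) ∧ |y.2 i| ≤ max (√(M / S.b₂)) (√(M / S.b₁)) := by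
  have h1 := h {i}
  rw [Finset.sum_singleton] at h1
  exact abs_le_of_siteEnergy_le hS h1

theorem isClosed_setOf_mem_energySublevel {Z : Type*} [TopologicalSpace Z]
    {y : Z → (ℤ → ℝ) × (ℤ → ℝ)} (hy : Continuous y) {M : Z → ℝ} (hM : Continuous M) :
    IsClosed {z | y z ∈ S.energySublevel (M z)} := by
  have : {z | y z ∈ S.energySublevel (M z)} = ⋂ J : Finset ℤ,
      {z | ∑ i ∈ J, S.siteEnergy ((y z).1 i) ((y z).2 i) ≤ M z} := by
    ext z; simp [energySublevel]
  rw [this]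
  refine isClosed_iInter fun J => isClosed_le ?_ hM
  unfold siteEnergy
  fun_prop

/-- Tychonoff: the coordinates are uniformly bounded and the energy bound is a family of closed
conditions on finitely many coordinates. This makes an energy bound suffice for tightness, with no
tail estimates. -/
theorem isCompact_energySublevel (hS : S.Admissible) (M : ℝ) :
    IsCompact (S.energySublevel M) := by
  set r := max (√(M / S.b₂)) (√(M / S.b₁))
  have hcpt : IsCompact (Set.univ.pi fun _ : ℤ => Set.Icc (-r) r) :=
    isCompact_univ_pi fun _ => isCompact_Icc
  refine (hcpt.prod hcpt).of_isClosed_subset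
    (isClosed_setOf_mem_energySublevel continuous_id continuous_const) fun y hy => ?_
  exact ⟨fun i _ => abs_le.1 (abs_le_of_mem_energySublevel hS hy i).1,
    fun i _ => abs_le.1 (abs_le_of_mem_energySublevel hS hy i).2⟩

theorem stateCoords_mem_energySublevel (hS : S.Admissible) (x : PhaseSpace) {M : ℝ}
    (h : S.energy x ≤ M) : stateCoords x ∈ S.energySublevel M :=
  fun J => (sum_siteEnergy_le_energy hS x J).trans h

/-! ### The noise and the closed step relation. -/

/-- The conditions on the noise intensities. -/
structure NoiseBound (S : SelkovData) (L : ℝ) (δ : Ell2) (β : ℝ) : Prop where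
  lipschitz : ∀ (i : ℤ) (s t : ℝ), |S.σ i s - S.σ i t| ≤ L * |s - t|
  growth : ∀ (i : ℤ) (s : ℝ), |S.σ i s| ≤ δ i + β * |s|

variable {L β : ℝ} {δ : Ell2}

theorem NoiseBound.continuous (hσ : S.NoiseBound L δ β) (i : ℤ) : Continuous (S.σ i) := by
  refine (LipschitzWith.of_dist_le_mul (K := L.toNNReal) fun s t => ?_).continuous
  rw [Real.dist_eq, Real.dist_eq]
  exact (hσ.lipschitz i s t).trans
    (mul_le_mul_of_nonneg_right (Real.le_coe_toNNReal L) (abs_nonneg _))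

/-- Two uses of (a + b)² ≤ 2a² + 2b², with `|β * s|` kept apart so that its coefficient is only 2.
Passing from `β * |s|` to `|β * s|` allows either sign of β. -/
theorem NoiseBound.sq_le (hσ : S.NoiseBound L δ β) (i : ℤ) (s : ℝ) :
    (S.h i + S.σ i s) ^ 2 ≤ 4 * S.h i ^ 2 + 4 * δ i ^ 2 + 2 * β ^ 2 * s ^ 2 := by
  have h1 : |S.h i + S.σ i s| ≤ |S.h i| + |δ i| + |β * s| := by
    refine (abs_add_le _ _).trans ?_
    have h2 : β * |s| ≤ |β * s| := by
      rw [abs_mul]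
      exact mul_le_mul_of_nonneg_right (le_abs_self β) (abs_nonneg s)
    linarith [hσ.growth i s, le_abs_self (δ i)]
  have h3 := pow_le_pow_left₀ (abs_nonneg _) h1 2
  rw [sq_abs] at h3
  nlinarith [sq_nonneg (|S.h i| + |δ i| - |β * s|), sq_nonneg (|S.h i| - |δ i|), sq_abs (S.h i),
    sq_abs (δ i), sq_abs (β * s)]

theorem NoiseBound.memℓp (hσ : S.NoiseBound L δ β) (u : Ell2) :
    Memℓp (fun i => S.h i + S.σ i (u i)) 2 := by
  refine Ell2.memℓp_of_sum_sq_le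
    (C := 4 * ‖S.h‖ ^ 2 + 4 * ‖δ‖ ^ 2 + 2 * β ^ 2 * ‖u‖ ^ 2) fun J => ?_
  refine (Finset.sum_le_sum fun i _ => hσ.sq_le i (u i)).trans ?_
  exact sum_le_hasSum J (fun i _ => by positivity)
    ((((Ell2.hasSum_sq S.h).mul_left 4).add ((Ell2.hasSum_sq δ).mul_left 4)).add
      ((Ell2.hasSum_sq u).mul_left (2 * β ^ 2)))

/-- The noise coefficient `h + σ(u)` as an element of `ℓ²`. -/
def NoiseBound.coeff (hσ : S.NoiseBound L δ β) (u : Ell2) : Ell2 :=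
  ⟨fun i => S.h i + S.σ i (u i), hσ.memℓp u⟩

theorem NoiseBound.norm_sq_coeff_le (hσ : S.NoiseBound L δ β) (u : Ell2) :
    ‖hσ.coeff u‖ ^ 2 ≤ 4 * ‖S.h‖ ^ 2 + 4 * ‖δ‖ ^ 2 + 2 * β ^ 2 * ‖u‖ ^ 2 :=
  hasSum_le (fun i => hσ.sq_le i (u i)) (Ell2.hasSum_sq (hσ.coeff u))
    ((((Ell2.hasSum_sq S.h).mul_left 4).add ((Ell2.hasSum_sq δ).mul_left 4)).add
      ((Ell2.hasSum_sq u).mul_left (2 * β ^ 2)))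

theorem NoiseBound.continuous_coeff (hσ : S.NoiseBound L δ β) : Continuous hσ.coeff := by
  refine (LipschitzWith.of_dist_le_mul (K := |L|.toNNReal) fun u v => ?_).continuous
  rw [dist_eq_norm, dist_eq_norm, Real.coe_toNNReal _ (abs_nonneg L)]
  refine (pow_le_pow_iff_left₀ (norm_nonneg _) (by positivity) two_ne_zero).1 ?_
  rw [mul_pow, sq_abs]
  refine Ell2.norm_sq_le_of_sq_le fun i => ?_
  have h1 : (hσ.coeff u - hσ.coeff v) i = S.σ i (u i) - S.σ i (v i) := by
    change (S.h i + S.σ i (u i)) - (S.h i + S.σ i (v i)) = _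
    ring
  have h2 : (u - v) i = u i - v i := rfl
  rw [h1, h2, ← sq_abs (S.σ i (u i) - S.σ i (v i)), ← sq_abs (u i - v i), ← mul_pow]
  exact pow_le_pow_left₀ (abs_nonneg _) (hσ.lipschitz i _ _) 2

/-- The explicit part of a step, before the noise is added. -/
noncomputable def drift (S : SelkovData) (Δ : ℝ) (x : PhaseSpace) : PhaseSpace :=
  (x.1 + Δ • S.f, x.2 + Δ • S.g)

/-- The noise coefficient of a step. -/
def NoiseBound.diffusion (hσ : S.NoiseBound L δ β) (x : PhaseSpace) : PhaseSpace :=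
  (hσ.coeff x.1, hσ.coeff x.2)

/-- The right-hand side of the implicit equations. -/
noncomputable def NoiseBound.source (hσ : S.NoiseBound L δ β) (Δ : ℝ) (z : PhaseSpace × ℝ) : PhaseSpace :=
  S.drift Δ z.1 + z.2 • hσ.diffusion z.1

theorem NoiseBound.continuous_source (hσ : S.NoiseBound L δ β) (Δ : ℝ) :
    Continuous (hσ.source Δ) := by
  have := hσ.continuous_coeff
  unfold source drift diffusion
  fun_prop

/-- The relation between coordinates that is defined by an implicit step. -/
def stepRelation (S : SelkovData) (Δ : ℝ) :
    Set ((((ℤ → ℝ) × (ℤ → ℝ)) × ℝ) × ((ℤ → ℝ) × (ℤ → ℝ))) :=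
  {z | (∀ i, S.residualU Δ (fun j => z.1.1.1 j + Δ * S.f j
        + z.1.2 * (S.h j + S.σ j (z.1.1.1 j))) z.2.1 z.2.2 i = 0) ∧
      ∀ i, S.residualV Δ (fun j => z.1.1.2 j + Δ * S.g j
        + z.1.2 * (S.h j + S.σ j (z.1.1.2 j))) z.2.1 z.2.2 i = 0}

theorem isBEMStep_iff {Δ w : ℝ} {x y : PhaseSpace} :
    IsBEMStep S Δ w x y ↔ ((stateCoords x, w), stateCoords y) ∈ S.stepRelation Δ := by
  unfold IsBEMStep stepRelation residualU residualV latticeLaplacian latticeA selkovF selkovG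
    stateCoords
  refine and_congr (forall_congr' fun i => ?_) (forall_congr' fun i => ?_)
  all_goals
    constructor
    · intro h
      linarith
    · intro h
      linarith

theorem NoiseBound.isClosed_stepRelation (hσ : S.NoiseBound L δ β) (Δ : ℝ) :
    IsClosed (S.stepRelation Δ) := by
  have hc := hσ.continuous
  have h1 : ∀ i, IsClosed {z : (((ℤ → ℝ) × (ℤ → ℝ)) × ℝ) × ((ℤ → ℝ) × (ℤ → ℝ)) |
      S.residualU Δ (fun j => z.1.1.1 j + Δ * S.f j
        + z.1.2 * (S.h j + S.σ j (z.1.1.1 j))) z.2.1 z.2.2 i = 0} := by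
    intro i
    have := hc i
    refine isClosed_eq ?_ continuous_const
    unfold residualU latticeLaplacian
    fun_prop
  have h2 : ∀ i, IsClosed {z : (((ℤ → ℝ) × (ℤ → ℝ)) × ℝ) × ((ℤ → ℝ) × (ℤ → ℝ)) |
      S.residualV Δ (fun j => z.1.1.2 j + Δ * S.g j
        + z.1.2 * (S.h j + S.σ j (z.1.1.2 j))) z.2.1 z.2.2 i = 0} := by
    intro i
    have := hc i
    refine isClosed_eq ?_ continuous_const
    unfold residualV latticeLaplacian
    fun_prop
  have h3 := (isClosed_iInter h1).inter (isClosed_iInter h2)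
  convert! h3 using 1
  ext z
  simp [stepRelation]

end SelkovData

/-! ### Measurable step map and contraction of the mean energy. -/

namespace SelkovData

variable {S : SelkovData} {L β : ℝ} {δ : Ell2}

/-- The implicit step has a measurable solution map that satisfies the energy bound. -/
theorem NoiseBound.exists_measurable_step (hσ : S.NoiseBound L δ β) (hS : S.Admissible) {Δ : ℝ}
    (hΔ : 0 < Δ) : ∃ s : PhaseSpace × ℝ → PhaseSpace, Measurable s ∧
      (∀ z : PhaseSpace × ℝ, ((stateCoords z.1, z.2), stateCoords (s z)) ∈ S.stepRelation Δ) ∧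
      ∀ z, S.energy (s z) ≤ S.energy (hσ.source Δ z) / (1 + min S.a₁ S.a₂ * Δ) ^ 2 := by
  have ha : 0 < min S.a₁ S.a₂ := lt_min hS.a₁_pos hS.a₂_pos
  set c := 1 + min S.a₁ S.a₂ * Δ with hc
  have hc0 : 0 < c ^ 2 := by positivity
  set M : PhaseSpace × ℝ → ℝ := fun z => S.energy (hσ.source Δ z) / c ^ 2 with hM
  have hMc : Continuous M := (continuous_energy.comp (hσ.continuous_source Δ)).div_const _
  -- `r z` bounds every coordinate of a solution within the energy bound. Rescaling by it places
  -- solutions in one compact cube independent of z, as the selection theorem requires.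
  set r : PhaseSpace × ℝ → ℝ := fun z => max (√(M z / S.b₂)) (√(M z / S.b₁)) with hr
  have hrc : Continuous r := by fun_prop
  set y : (PhaseSpace × ℝ) × ((ℤ → Set.Icc (-1 : ℝ) 1) × (ℤ → Set.Icc (-1 : ℝ) 1)) →
    (ℤ → ℝ) × (ℤ → ℝ) :=
    fun q => (fun i => r q.1 * q.2.1 i, fun i => r q.1 * q.2.2 i) with hy
  have hyc : Continuous y := by fun_prop
  set G : Set ((PhaseSpace × ℝ) × ((ℤ → Set.Icc (-1 : ℝ) 1) × (ℤ → Set.Icc (-1 : ℝ) 1))) :=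
    {q | ((stateCoords q.1.1, q.1.2), y q) ∈ S.stepRelation Δ} ∩
      {q | y q ∈ S.energySublevel (M q.1)} with hG
  have hGc : IsClosed G := by
    refine IsClosed.inter ?_
      (isClosed_setOf_mem_energySublevel hyc (hMc.comp continuous_fst))
    exact (hσ.isClosed_stepRelation Δ).preimage
      (((continuous_stateCoords.comp (continuous_fst.comp continuous_fst)).prodMk
        (continuous_snd.comp continuous_fst)).prodMk hyc)
  have hne : ∀ z, ∃ t, (z, t) ∈ G := by
    intro z
    obtain ⟨u, v, hu, hv, hq⟩ := exists_solution hS hΔ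
      (fun i => (hσ.source Δ z).1 i) (fun i => (hσ.source Δ z).2 i)
      (sum_siteEnergy_le_energy hS (hσ.source Δ z))
    have hmem : (u, v) ∈ S.energySublevel (M z) := fun J => by
      rw [hM, le_div_iff₀ hc0, mul_comm]
      exact hq J
    have habs := abs_le_of_mem_energySublevel hS hmem
    have hr0 : 0 ≤ r z := (Real.sqrt_nonneg _).trans (le_max_left _ _)
    have hscale : ∀ a : ℝ, |a| ≤ r z → a / r z ∈ Set.Icc (-1 : ℝ) 1 ∧ r z * (a / r z) = a := by
      intro a h
      -- If `r z = 0` the coordinate vanishes, and division by zero returns the correct value 0.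
      rcases hr0.eq_or_lt with h0 | h0
      · rw [← h0] at h ⊢
        have : a = 0 := abs_eq_zero.1 (le_antisymm h (abs_nonneg a))
        simp [this]
      · refine ⟨?_, mul_div_cancel₀ _ h0.ne'⟩
        rw [Set.mem_Icc, ← abs_le, abs_div, abs_of_pos h0, div_le_one h0]
        exact h
    refine ⟨(fun i => ⟨u i / r z, (hscale _ (habs i).1).1⟩,
      fun i => ⟨v i / r z, (hscale _ (habs i).2).1⟩), ?_⟩
    have hyz : y (z, (fun i => ⟨u i / r z, (hscale _ (habs i).1).1⟩,
        fun i => ⟨v i / r z, (hscale _ (habs i).2).1⟩)) = (u, v) :=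
      Prod.ext (funext fun i => (hscale _ (habs i).1).2) (funext fun i => (hscale _ (habs i).2).2)
    refine ⟨?_, ?_⟩
    · rw [Set.mem_ofPred_eq, hyz]
      exact ⟨hu, hv⟩
    · rw [Set.mem_ofPred_eq, hyz]
      exact hmem
  obtain ⟨t, htm, htG⟩ := exists_measurable_selection_of_isClosed hGc hne
  choose s hs hsM using fun z => exists_state_of_sum_siteEnergy_le hS (htG z).2
  refine ⟨s, ?_, fun z => ?_, hsM⟩
  · refine measurableEmbedding_stateCoords.measurable_comp_iff.1 ?_
    have : stateCoords ∘ s = fun z => y (z, t z) := funext hs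
    rw [this]
    exact hyc.measurable.comp (measurable_id.prodMk htm)
  · rw [hs]
    exact (htG z).1

/-- Mean of a quadratic polynomial of a centred Gaussian variable. -/
theorem integral_quadratic_gaussianReal {Δ : ℝ} (hΔ : 0 < Δ) (a b c : ℝ) :
    Integrable (fun w : ℝ => a + b * w + c * w ^ 2) (gaussianReal 0 Δ.toNNReal) ∧
    ∫ w, (a + b * w + c * w ^ 2) ∂(gaussianReal 0 Δ.toNNReal) = a + c * Δ := by
  have h1 : Integrable (fun w : ℝ => w) (gaussianReal 0 Δ.toNNReal) :=
    memLp_one_iff_integrable.1 (memLp_id_gaussianReal 1)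
  have h2 : Integrable (fun w : ℝ => w ^ 2) (gaussianReal 0 Δ.toNNReal) :=
    (memLp_id_gaussianReal 2).integrable_sq
  have e1 : ∫ w, w ∂(gaussianReal 0 Δ.toNNReal) = 0 := integral_id_gaussianReal
  have e2 : ∫ w, w ^ 2 ∂(gaussianReal 0 Δ.toNNReal) = Δ := by
    have h := variance_of_integral_eq_zero (μ := gaussianReal 0 Δ.toNNReal) (X := id)
      measurable_id.aemeasurable e1
    rw [variance_id_gaussianReal, Real.coe_toNNReal _ hΔ.le] at h
    exact h.symm
  have h3 : Integrable (fun w : ℝ => a + b * w) (gaussianReal 0 Δ.toNNReal) :=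
    (integrable_const a).add (h1.const_mul b)
  refine ⟨h3.add (h2.const_mul c), ?_⟩
  rw [integral_add h3 (h2.const_mul c), integral_add (integrable_const a) (h1.const_mul b),
    integral_const_mul, integral_const_mul, e1, e2]
  simp

theorem energy_add_smul (x y : PhaseSpace) (w : ℝ) :
    S.energy (x + w • y) = S.energy x
      + 2 * (S.b₂ * inner ℝ x.1 y.1 + S.b₁ * inner ℝ x.2 y.2) * w + S.energy y * w ^ 2 := by
  unfold energy
  rw [Prod.fst_add, Prod.snd_add, Prod.smul_fst, Prod.smul_snd, norm_add_sq_real,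
    norm_add_sq_real, inner_smul_right, inner_smul_right, norm_smul, norm_smul, mul_pow, mul_pow,
    Real.norm_eq_abs, sq_abs]
  ring

/-- Young's inequality with a free weight. With θ = λΔ the forcing costs only a factor 1 + λΔ, which
the denominator (1 + λΔ)² absorbs. -/
theorem norm_add_smul_sq_le {E : Type*} [NormedAddCommGroup E] [InnerProductSpace ℝ E]
    {θ : ℝ} (hθ : 0 < θ) (x y : E) (t : ℝ) :
    ‖x + t • y‖ ^ 2 ≤ (1 + θ) * ‖x‖ ^ 2 + (1 + θ⁻¹) * (t ^ 2 * ‖y‖ ^ 2) := by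
  have h1 : ‖x + t • y‖ ≤ ‖x‖ + |t| * ‖y‖ := by
    refine (norm_add_le _ _).trans_eq ?_
    rw [norm_smul, Real.norm_eq_abs]
  have h2 := pow_le_pow_left₀ (norm_nonneg _) h1 2
  have h3 : 0 ≤ θ⁻¹ * (θ * ‖x‖ - |t| * ‖y‖) ^ 2 := by positivity
  have h4 : θ⁻¹ * (θ * ‖x‖ - |t| * ‖y‖) ^ 2
      = θ * ‖x‖ ^ 2 - 2 * (‖x‖ * (|t| * ‖y‖)) + θ⁻¹ * (t ^ 2 * ‖y‖ ^ 2) := by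
    rw [← sq_abs t]
    field_simp
    ring
  have h5 : (‖x‖ + |t| * ‖y‖) ^ 2
      = ‖x‖ ^ 2 + 2 * (‖x‖ * (|t| * ‖y‖)) + t ^ 2 * ‖y‖ ^ 2 := by
    rw [← sq_abs t]
    ring
  linarith

/-- The energy contracts on average under an implicit step, up to a constant. -/
theorem NoiseBound.exists_lintegral_energy_le (hσ : S.NoiseBound L δ β) (hS : S.Admissible)
    (hβ : 2 * β ^ 2 < min S.a₁ S.a₂) {Δ : ℝ} (hΔ : 0 < Δ) {s : PhaseSpace × ℝ → PhaseSpace}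
    (hs : ∀ z, S.energy (s z) ≤ S.energy (hσ.source Δ z) / (1 + min S.a₁ S.a₂ * Δ) ^ 2) :
    ∃ ρ C : ℝ, 0 ≤ ρ ∧ ρ < 1 ∧ 0 ≤ C ∧ ∀ x,
      ∫⁻ w, ENNReal.ofReal (S.energy (s (x, w))) ∂(gaussianReal 0 Δ.toNNReal)
        ≤ ENNReal.ofReal (ρ * S.energy x + C) := by
  have hb1 := hS.b₁_pos
  have hb2 := hS.b₂_pos
  have ha : 0 < min S.a₁ S.a₂ := lt_min hS.a₁_pos hS.a₂_pos
  set lam := min S.a₁ S.a₂ with hlam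
  set c := (1 + lam * Δ) ^ 2 with hc
  have hc0 : 0 < c := by positivity
  set θ := lam * Δ with hθ
  have hθ0 : 0 < θ := by positivity
  set C₀ := 4 * ‖S.h‖ ^ 2 + 4 * ‖δ‖ ^ 2 with hC₀
  set D := (1 + θ⁻¹) * (Δ ^ 2 * (S.b₂ * ‖S.f‖ ^ 2 + S.b₁ * ‖S.g‖ ^ 2))
    + Δ * ((S.b₂ + S.b₁) * C₀) with hD
  have hD0 : 0 ≤ D := by positivity
  -- The ratio is below 1 because 2β²Δ < θ gives 1 + θ + 2β²Δ < 1 + 2θ ≤ (1 + θ)².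
  refine ⟨(1 + θ + 2 * β ^ 2 * Δ) / c, D / c, by positivity, ?_, by positivity, fun x => ?_⟩
  · rw [div_lt_one hc0, hc]
    have := mul_lt_mul_of_pos_right hβ hΔ
    nlinarith [sq_nonneg θ]
  · set A := S.drift Δ x
    set B := hσ.diffusion x
    have hA : S.energy A ≤ (1 + θ) * S.energy x
        + (1 + θ⁻¹) * (Δ ^ 2 * (S.b₂ * ‖S.f‖ ^ 2 + S.b₁ * ‖S.g‖ ^ 2)) := by
      have e1 := mul_le_mul_of_nonneg_left (norm_add_smul_sq_le hθ0 x.1 S.f Δ) hb2.le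
      have e2 := mul_le_mul_of_nonneg_left (norm_add_smul_sq_le hθ0 x.2 S.g Δ) hb1.le
      have e3 : S.energy A = S.b₂ * ‖x.1 + Δ • S.f‖ ^ 2 + S.b₁ * ‖x.2 + Δ • S.g‖ ^ 2 := rfl
      have e4 : S.energy x = S.b₂ * ‖x.1‖ ^ 2 + S.b₁ * ‖x.2‖ ^ 2 := rfl
      rw [e3, e4]
      linarith
    have hB : S.energy B ≤ (S.b₂ + S.b₁) * C₀ + 2 * β ^ 2 * S.energy x := by
      have e1 := mul_le_mul_of_nonneg_left (hσ.norm_sq_coeff_le x.1) hb2.le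
      have e2 := mul_le_mul_of_nonneg_left (hσ.norm_sq_coeff_le x.2) hb1.le
      have e3 : S.energy B = S.b₂ * ‖hσ.coeff x.1‖ ^ 2 + S.b₁ * ‖hσ.coeff x.2‖ ^ 2 := rfl
      have e4 : S.energy x = S.b₂ * ‖x.1‖ ^ 2 + S.b₁ * ‖x.2‖ ^ 2 := rfl
      rw [e3, e4, hC₀]
      linarith
    obtain ⟨hint, hval⟩ := integral_quadratic_gaussianReal hΔ (S.energy A)
      (2 * (S.b₂ * inner ℝ A.1 B.1 + S.b₁ * inner ℝ A.2 B.2)) (S.energy B)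
    have hsrc : ∀ w, S.energy (hσ.source Δ (x, w)) = S.energy A
        + 2 * (S.b₂ * inner ℝ A.1 B.1 + S.b₁ * inner ℝ A.2 B.2) * w + S.energy B * w ^ 2 :=
      fun w => energy_add_smul A B w
    have hint' : Integrable (fun w => S.energy (hσ.source Δ (x, w)) / c)
        (gaussianReal 0 Δ.toNNReal) := by
      simp_rw [hsrc]
      exact hint.div_const c
    calc ∫⁻ w, ENNReal.ofReal (S.energy (s (x, w))) ∂(gaussianReal 0 Δ.toNNReal)
        ≤ ∫⁻ w, ENNReal.ofReal (S.energy (hσ.source Δ (x, w)) / c)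
            ∂(gaussianReal 0 Δ.toNNReal) :=
          lintegral_mono fun w => ENNReal.ofReal_le_ofReal (hs (x, w))
      _ = ENNReal.ofReal (∫ w, S.energy (hσ.source Δ (x, w)) / c
            ∂(gaussianReal 0 Δ.toNNReal)) :=
          (ofReal_integral_eq_lintegral_ofReal hint' (Filter.Eventually.of_forall fun w =>
            div_nonneg (energy_nonneg hS _) hc0.le)).symm
      _ = ENNReal.ofReal ((S.energy A + S.energy B * Δ) / c) := by
          simp_rw [hsrc]
          rw [integral_div, hval]
      _ ≤ _ := by
          refine ENNReal.ofReal_le_ofReal ?_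
          rw [div_mul_eq_mul_div, ← add_div]
          refine div_le_div_of_nonneg_right ?_ hc0.le
          have := mul_le_mul_of_nonneg_right hB hΔ.le
          rw [hD]
          linarith

/-! ### Tightness of the chain and conclusion. -/

/-- The laws of the Markov chain that starts at rest and is driven by the step map `s`. -/
noncomputable def chainLaw (s : PhaseSpace × ℝ → PhaseSpace) (N : Measure ℝ) :
    ℕ → Measure PhaseSpace
  | 0 => Measure.dirac 0
  | n + 1 => ((chainLaw s N n).prod N).map s

theorem isProbabilityMeasure_chainLaw {s : PhaseSpace × ℝ → PhaseSpace} (hs : Measurable s)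
    (N : Measure ℝ) [IsProbabilityMeasure N] (n : ℕ) : IsProbabilityMeasure (chainLaw s N n) := by
  induction n with
  | zero => exact Measure.dirac.isProbabilityMeasure
  | succ n ih => exact Measure.isProbabilityMeasure_map hs.aemeasurable

/-- C/(1 − ρ) is the fixed point of m ↦ ρm + C, and the chain starts below it, with zero energy. -/
theorem lintegral_energy_chainLaw_le (hS : S.Admissible) {s : PhaseSpace × ℝ → PhaseSpace}
    (hs : Measurable s) (N : Measure ℝ) [IsProbabilityMeasure N] {ρ C : ℝ} (hρ0 : 0 ≤ ρ)
    (hρ1 : ρ < 1) (hC : 0 ≤ C)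
    (h : ∀ x, ∫⁻ w, ENNReal.ofReal (S.energy (s (x, w))) ∂N
      ≤ ENNReal.ofReal (ρ * S.energy x + C)) (n : ℕ) :
    ∫⁻ x, ENNReal.ofReal (S.energy x) ∂(chainLaw s N n) ≤ ENNReal.ofReal (C / (1 - ρ)) := by
  have hm : Measurable fun x => ENNReal.ofReal (S.energy x) :=
    continuous_energy.measurable.ennreal_ofReal
  have h1 : 0 < 1 - ρ := by linarith
  induction n with
  | zero =>
    rw [chainLaw, lintegral_dirac' _ hm]
    simp [energy]
  | succ n ih =>
    have := isProbabilityMeasure_chainLaw hs N n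
    have hms : Measurable fun z => ENNReal.ofReal (S.energy (s z)) := hm.comp hs
    rw [chainLaw, lintegral_map hm hs, lintegral_prod _ hms.aemeasurable]
    calc ∫⁻ x, ∫⁻ w, ENNReal.ofReal (S.energy (s (x, w))) ∂N ∂(chainLaw s N n)
        ≤ ∫⁻ x, (ENNReal.ofReal ρ * ENNReal.ofReal (S.energy x) + ENNReal.ofReal C)
            ∂(chainLaw s N n) := by
          refine lintegral_mono fun x => (h x).trans_eq ?_
          rw [ENNReal.ofReal_add (mul_nonneg hρ0 (energy_nonneg hS x)) hC, ENNReal.ofReal_mul hρ0]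
      _ = ENNReal.ofReal ρ * ∫⁻ x, ENNReal.ofReal (S.energy x) ∂(chainLaw s N n)
            + ENNReal.ofReal C := by
          rw [lintegral_add_right _ measurable_const, lintegral_const_mul _ hm, lintegral_const,
            measure_univ, mul_one]
      _ ≤ ENNReal.ofReal ρ * ENNReal.ofReal (C / (1 - ρ)) + ENNReal.ofReal C := by gcongr
      _ = ENNReal.ofReal (C / (1 - ρ)) := by
          rw [← ENNReal.ofReal_mul hρ0, ← ENNReal.ofReal_add (by positivity) hC]
          congr 1
          field_simp
          ring

theorem exists_chainLaw_compl_energySublevel_le (hS : S.Admissible)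
    {s : PhaseSpace × ℝ → PhaseSpace} {N : Measure ℝ} {m : ℝ}
    (h : ∀ n, ∫⁻ x, ENNReal.ofReal (S.energy x) ∂(chainLaw s N n) ≤ ENNReal.ofReal m)
    {ε : ENNReal} (hε : 0 < ε) :
    ∃ k : ℕ, ∀ n, chainLaw s N n (stateCoords ⁻¹' (S.energySublevel k))ᶜ ≤ ε := by
  obtain ⟨k, hk⟩ := ENNReal.exists_nat_gt (ENNReal.div_lt_top ENNReal.ofReal_ne_top hε.ne' :
    ENNReal.ofReal m / ε < ⊤).ne
  have hk0 : (k : ENNReal) ≠ 0 := (pos_of_gt hk).ne'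
  refine ⟨k, fun n => ?_⟩
  have hsub : (stateCoords ⁻¹' (S.energySublevel k))ᶜ
      ⊆ {x | (k : ENNReal) ≤ ENNReal.ofReal (S.energy x)} := by
    intro x hx
    by_contra hlt
    refine hx (stateCoords_mem_energySublevel hS x ?_)
    rw [Set.mem_ofPred_eq, not_le, ← ENNReal.ofReal_natCast] at hlt
    exact ((ENNReal.ofReal_lt_ofReal_iff_of_nonneg (energy_nonneg hS x)).1 hlt).le
  calc chainLaw s N n _ ≤ chainLaw s N n {x | (k : ENNReal) ≤ ENNReal.ofReal (S.energy x)} :=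
        measure_mono hsub
    _ ≤ (∫⁻ x, ENNReal.ofReal (S.energy x) ∂(chainLaw s N n)) / k :=
        meas_ge_le_lintegral_div continuous_energy.measurable.ennreal_ofReal.aemeasurable hk0
          (ENNReal.natCast_ne_top k)
    _ ≤ ENNReal.ofReal m / k := by gcongr; exact h n
    _ ≤ ε := by
        refine ENNReal.div_le_of_le_mul' ?_
        exact ((ENNReal.div_le_iff_le_mul (Or.inl hε.ne') (Or.inr hk0)).1
          hk.le)

/-- The scheme has an invariant probability measure for every step size. -/
theorem NoiseBound.exists_isBEMInvariantMeasure (hσ : S.NoiseBound L δ β) (hS : S.Admissible)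
    (hβ : 2 * β ^ 2 < min S.a₁ S.a₂) {Δ : ℝ} (hΔ : 0 < Δ) :
    ∃ μ : Measure PhaseSpace, IsBEMInvariantMeasure S Δ μ := by
  obtain ⟨s, hs, hsR, hsE⟩ := hσ.exists_measurable_step hS hΔ
  obtain ⟨ρ, C, hρ0, hρ1, hC, hle⟩ := hσ.exists_lintegral_energy_le hS hβ hΔ hsE
  have hprob := isProbabilityMeasure_chainLaw hs (gaussianReal 0 Δ.toNNReal)
  obtain ⟨K, hK, hKR, μ, hμ, hinv⟩ := exists_invariant_of_isClosed_relation
    measurableEmbedding_stateCoords (gaussianReal 0 Δ.toNNReal) (hσ.isClosed_stepRelation Δ) hs hsR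
    (C := fun k : ℕ => S.energySublevel k) (fun k => isCompact_energySublevel hS k)
    (fun k y hy => by
      obtain ⟨x, hx, -⟩ := exists_state_of_sum_siteEnergy_le hS hy
      exact ⟨x, hx⟩)
    (chainLaw s (gaussianReal 0 Δ.toNNReal)) (fun n => rfl)
    (fun ε hε => exists_chainLaw_compl_energySublevel_le hS
      (lintegral_energy_chainLaw_le hS hs _ hρ0 hρ1 hC hle) hε)
  refine ⟨μ, hμ, K ∘ₖ withIncrement Δ, ⟨K, hK, fun x w => ?_, rfl⟩, ?_⟩
  · filter_upwards [hKR (x, w)] with y hy using isBEMStep_iff.2 hy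
  · have hinc : μ.bind (withIncrement Δ) = μ.prod (gaussianReal 0 Δ.toNNReal) := by
      rw [withIncrement, ← Measure.compProd_eq_comp_prod, Measure.compProd_const]
    rw [Kernel.Invariant, ← Measure.comp_assoc, hinc, hinv]

end SelkovData

theorem theorem3p1 (S : SelkovData) (hp : 1 ≤ S.p)
    (hd₁ : 0 < S.d₁) (hd₂ : 0 < S.d₂) (ha₁ : 0 < S.a₁) (ha₂ : 0 < S.a₂)
    (hb₁ : 0 < S.b₁) (hb₂ : 0 < S.b₂)
    (L : ℝ) (hL : 0 < L)
    (hLip : ∀ (i : ℤ) (s t : ℝ), |S.σ i s - S.σ i t| ≤ L * |s - t|)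
    (δ : Ell2) (β : ℝ)
    (hgrowth : ∀ (i : ℤ) (s : ℝ), |S.σ i s| ≤ δ i + β * |s|)
    (hlam : 16 * β ^ 2 < min S.a₁ S.a₂) :
    ∃ Δstar : ℝ, 0 < Δstar ∧ ∀ Δ : ℝ, 0 < Δ → Δ < Δstar →
      ∃ μ : Measure PhaseSpace, IsBEMInvariantMeasure S Δ μ := by
  have hσ : S.NoiseBound L δ β := ⟨hLip, hgrowth⟩
  have hS : S.Admissible := ⟨hd₁, hd₂, ha₁, ha₂, hb₁, hb₂⟩
  -- The threshold 1 is arbitrary: the energy contracts on average for every Δ > 0, and 2β² ≤ 16β².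
  refine ⟨1, one_pos, fun Δ hΔ _ => hσ.exists_isBEMInvariantMeasure hS ?_ hΔ⟩
  linarith [sq_nonneg β]
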